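/- Throughout, $M$ is a (Hausdorff) smooth real manifold of dimension $n$. A hom-Lie algebra $(\mathfrak h,[\cdot,\cdot],\phi)$ is a real vector space with a skew-symmetric bilinear bracket and a linear map $\phi$ with $\phi[x,y]=[\phi x,\phi y]$ and $[\phi x,[y,z]]+[\phi y,[z,x]]+[\phi z,[x,y]]=0$; it is involutive if $\phi^2=\mathrm{Id}$. For $r=\sum_i x_i\otimes y_i\in\mathfrak h\otimes\mathfrak h$ write $r=\Lambda+S$ with $\Lambda$ skew-symmetric and $S$ symmetric. Then $r$ is called a quasi-triangular hom-$r$-matrix if $(\phi\otimes\phi)(r)=r$, if $S=\sum_i s_i\otimes t_i$ satisfies $\sum_i\big([x,s_i]\otimes\phi(t_i)+\phi(s_i)\otimes[x,t_i]\big)=0$ for all $x\in\mathfrak h$, and if $$\sum_{i,j}\big([x_i,x_j]\otimes\phi(y_i)\otimes\phi(y_j)+\phi(x_i)\otimes[y_i,x_j]\otimes\phi(y_j)+\phi(x_i)\otimes\phi(x_j)\otimes[y_i,y_j]\big)=0.$$ Put $S^\sharp(\xi)=\sum_i\langle\xi,\phi(s_i)\rangle t_i$ for $\xi\in\mathfrak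 h^*$. Let $\varphi:M\to M$ be a diffeomorphism, $\varphi^*f=f\circ\varphi$ on $C^\infty(M)$, and $\Gamma(\varphi^!TM)=\{X\circ\varphi: X \text{ a smooth vector field on } M\}$, whose elements act on functions by $x(f)(p)=df_{\varphi(p)}(x(p))$. Put $\mathrm{Ad}_{\varphi^*}(x)=\varphi^*\circ x\circ(\varphi^*)^{-1}$ and $[x,y]_{\varphi^*}=\varphi^*\circ x\circ(\varphi^*)^{-1}\circ y\circ(\varphi^*)^{-1}-\varphi^*\circ y\circ(\varphi^*)^{-1}\circ x\circ(\varphi^*)^{-1}$. An action of $\mathfrak h$ on $M$ along $\varphi$ is a linear map $\sigma:\mathfrak h\to\Gamma(\varphi^!TM)$ with $\sigma(\phi(x))=\mathrm{Ad}_{\varphi^*}(\sigma(x))$ and $\sigma([x,y])=[\sigma(x),\sigma(y)]_{\varphi^*}$; put $\sigma(r)=\sum_i\sigma(x_i)\otimes\sigma(y_i)$. The hom-Schouten bracket on $\wedge^2\Gamma(\varphi^!TM)$ (the finite sums of bisections $x\wedge y=x\otimes y-y\otimes x$ with $x,y\in\Gamma(\varphi^!TM)$) is the bilinear operation with $$[[x\wedge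 y,z\wedge w]]=[x,z]_{\varphi^*}\wedge\mathrm{Ad}\,y\wedge\mathrm{Ad}\,w-[x,w]_{\varphi^*}\wedge\mathrm{Ad}\,y\wedge\mathrm{Ad}\,z-[y,z]_{\varphi^*}\wedge\mathrm{Ad}\,x\wedge\mathrm{Ad}\,w+[y,w]_{\varphi^*}\wedge\mathrm{Ad}\,x\wedge\mathrm{Ad}\,z,$$ where $\mathrm{Ad}=\mathrm{Ad}_{\varphi^*}$. A tensor field $\pi$ is a hom-Poisson structure on $(M,\varphi)$ if $\pi\in\wedge^2\Gamma(\varphi^!TM)$, $[[\pi,\pi]]=0$ and $\mathrm{Ad}_{\varphi^*}(\pi)=\pi$. For $y\in M$ let $\mathfrak q_y=\{a\in\mathfrak h:\sigma(a)(y)=0\}$ and $\mathfrak q_y^\perp=\{\xi\in\mathfrak h^*:\xi|_{\mathfrak q_y}=0\}$. Theorem. Let $(\mathfrak h,[\cdot,\cdot],\phi)$ be an involutive hom-Lie algebra, $r=\Lambda+S$ a quasi-triangular hom-$r$-matrix of $\mathfrak h$, and $\sigma$ an action of $\mathfrak h$ on $M$ along a diffeomorphism $\varphi$. (1) If $\phi(\mathfrak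 q_y)\subset\mathfrak q_y$ and $S^\sharp(\mathfrak q_y^\perp)\subset\mathfrak q_y$ for all $y\in M$, then $\sigma(r)$ is a hom-Poisson structure on $(M,\varphi)$. (2) $\sigma(\Lambda)$ is a hom-Poisson structure on $(M,\varphi)$ if and only if $[S^\sharp(\mathfrak q_y^\perp),S^\sharp(\mathfrak q_y^\perp)]\subset\mathfrak q_y$ for all $y\in M$. (3) Let $\mathfrak g$ be a real Lie algebra, $r=\Lambda+S$ a quasi-triangular $r$-matrix of $\mathfrak g$ (the above notion with $\phi=\mathrm{Id}$), $\sigma$ a Lie algebra homomorphism from $\mathfrak g$ to the smooth vector fields on $M$, and $\mathfrak q_m=\{a\in\mathfrak g:\sigma(a)(m)=0\}$. Then $\sigma(\Lambda)$ is a Poisson structure on $M$ (that is, $\{f,g\}=\sigma(\Lambda)(df,dg)$ is a Poisson bracket) if and only if $[S^\sharp(\mathfrak q_m^\perp),S^\sharp(\mathfrak q_m^\perp)]\subset\mathfrak q_m$ for all $m\in M$. (4) Let $((\mathfrak d,\langle\cdot,\cdot\rangle),\mathfrak g_1,\mathfrak g_2)$ be a finite-dimensional real Manin triple (a Lie algebra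 $\mathfrak d$ with a nondegenerate symmetric invariant bilinear form which is the vector space direct sum of the Lie subalgebras $\mathfrak g_1,\mathfrak g_2$, both isotropic), $(\xi_i)$ a basis of $\mathfrak g_2$, $(x_i)$ the dual basis of $\mathfrak g_1$, $\Lambda$ the skew-symmetric part of $\sum_i\xi_i\otimes x_i$, and $\sigma$ a Lie algebra homomorphism from $\mathfrak d$ to the smooth vector fields on $M$. Then $\sigma(\Lambda)$ is a Poisson structure on $M$ if and only if $[\mathfrak q_m^\perp,\mathfrak q_m^\perp]\subset\mathfrak q_m$ for all $m\in M$, where $\mathfrak q_m=\{a\in\mathfrak d:\sigma(a)(m)=0\}$ and $\mathfrak q_m^\perp\subset\mathfrak d$ is its orthogonal with respect to $\langle\cdot,\cdot\rangle$. -/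

import Mathlib

open scoped Manifold ContDiff TensorProduct

noncomputable section

namespace HomPoisson

/-! ### Hom-Lie algebras -/

/-- A (real) hom-Lie algebra structure on the vector space `h`: a skew-symmetric bilinear bracket
and an algebra endomorphism `phi` satisfying the hom-Jacobi identity. -/
structure HomLieAlgebra (h : Type*) [AddCommGroup h] [Module ℝ h] where
  bracket : h →ₗ[ℝ] h →ₗ[ℝ] h
  phi : h →ₗ[ℝ] h
  bracket_self : ∀ x, bracket x x = 0
  phi_bracket : ∀ x y, phi (bracket x y) = bracket (phi x) (phi y)
  hom_jacobi : ∀ x y z, bracket (phi x) (bracket y z) + bracket (phi y) (bracket z x)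
    + bracket (phi z) (bracket x y) = 0

/-- A Lie algebra, seen as a hom-Lie algebra with `phi = id`. -/
def HomLieAlgebra.ofLie (g : Type*) [LieRing g] [LieAlgebra ℝ g] : HomLieAlgebra g where
  bracket := LinearMap.mk₂ ℝ (fun x y => ⁅x, y⁆) add_lie smul_lie lie_add
    (fun c x y => lie_smul c x y)
  phi := LinearMap.id
  bracket_self x := by simp
  phi_bracket x y := by simp
  hom_jacobi x y z := by simpa using lie_jacobi x y z

section Tensors

variable {h : Type*} [AddCommGroup h] [Module ℝ h]

/-- The skew-symmetric part `Λ` of `r = Λ + S`. -/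
def skewPart (r : h ⊗[ℝ] h) : h ⊗[ℝ] h := (1 / 2 : ℝ) • (r - TensorProduct.comm ℝ h h r)

/-- The symmetric part `S` of `r = Λ + S`. -/
def symmPart (r : h ⊗[ℝ] h) : h ⊗[ℝ] h := (1 / 2 : ℝ) • (r + TensorProduct.comm ℝ h h r)

namespace HomLieAlgebra

variable (L : HomLieAlgebra h)

/-- `phi² = id`. -/
def IsInvolutive : Prop := ∀ x, L.phi (L.phi x) = x

/-- The linear map `(x ⊗ y) ⊗ (x' ⊗ y') ↦ [x, x'] ⊗ (φ y ⊗ φ y')`. -/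
def hcyb₁ : (h ⊗[ℝ] h) ⊗[ℝ] (h ⊗[ℝ] h) →ₗ[ℝ] h ⊗[ℝ] (h ⊗[ℝ] h) :=
  TensorProduct.map (TensorProduct.lift L.bracket) (TensorProduct.map L.phi L.phi) ∘ₗ
    (TensorProduct.tensorTensorTensorComm ℝ h h h h).toLinearMap

/-- The linear map `(x ⊗ y) ⊗ (x' ⊗ y') ↦ φ x ⊗ ([y, x'] ⊗ φ y')`. -/
def hcyb₂ : (h ⊗[ℝ] h) ⊗[ℝ] (h ⊗[ℝ] h) →ₗ[ℝ] h ⊗[ℝ] (h ⊗[ℝ] h) :=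
  TensorProduct.map L.phi
      (TensorProduct.map (TensorProduct.lift L.bracket) L.phi ∘ₗ
        (TensorProduct.assoc ℝ h h h).symm.toLinearMap) ∘ₗ
    (TensorProduct.assoc ℝ h h (h ⊗[ℝ] h)).toLinearMap

/-- The linear map `(x ⊗ y) ⊗ (x' ⊗ y') ↦ φ x ⊗ (φ x' ⊗ [y, y'])`. -/
def hcyb₃ : (h ⊗[ℝ] h) ⊗[ℝ] (h ⊗[ℝ] h) →ₗ[ℝ] h ⊗[ℝ] (h ⊗[ℝ] h) :=
  (TensorProduct.assoc ℝ h h h).toLinearMap ∘ₗ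
    TensorProduct.map (TensorProduct.map L.phi L.phi) (TensorProduct.lift L.bracket) ∘ₗ
      (TensorProduct.tensorTensorTensorComm ℝ h h h h).toLinearMap

/-- The hom-classical Yang-Baxter map: for `r = ∑ xᵢ ⊗ yᵢ`,
`HCYB(r) = ∑ᵢⱼ [xᵢ, xⱼ] ⊗ φ yᵢ ⊗ φ yⱼ + φ xᵢ ⊗ [yᵢ, xⱼ] ⊗ φ yⱼ + φ xᵢ ⊗ φ xⱼ ⊗ [yᵢ, yⱼ]`. -/
def hcyb (r : h ⊗[ℝ] h) : h ⊗[ℝ] (h ⊗[ℝ] h) :=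
  L.hcyb₁ (r ⊗ₜ r) + L.hcyb₂ (r ⊗ₜ r) + L.hcyb₃ (r ⊗ₜ r)

/-- The explicit formula for `HCYB` in terms of a presentation of `r`. -/
theorem hcyb_sum {ι : Type*} [Fintype ι] (x y : ι → h) :
    L.hcyb (∑ i, x i ⊗ₜ[ℝ] y i) = ∑ i, ∑ j,
      (L.bracket (x i) (x j) ⊗ₜ[ℝ] (L.phi (y i) ⊗ₜ[ℝ] L.phi (y j))
        + L.phi (x i) ⊗ₜ[ℝ] (L.bracket (y i) (x j) ⊗ₜ[ℝ] L.phi (y j))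
        + L.phi (x i) ⊗ₜ[ℝ] (L.phi (x j) ⊗ₜ[ℝ] L.bracket (y i) (y j))) := by
  simp only [hcyb, TensorProduct.sum_tmul, TensorProduct.tmul_sum, map_sum,
    Finset.sum_add_distrib]
  simp only [hcyb₁, hcyb₂, hcyb₃, LinearMap.comp_apply, LinearEquiv.coe_coe,
    TensorProduct.tensorTensorTensorComm_tmul, TensorProduct.map_tmul, TensorProduct.lift.tmul,
    TensorProduct.assoc_tmul, TensorProduct.assoc_symm_tmul]
  congr 1
  · congr 1 <;> exact Finset.sum_comm
  · exact Finset.sum_comm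

/-- Hom-ad-invariance of `s = ∑ xᵢ ⊗ yᵢ`: `∑ [x, xᵢ] ⊗ φ yᵢ + φ xᵢ ⊗ [x, yᵢ] = 0` for all `x`. -/
def IsHomAdInvariant (s : h ⊗[ℝ] h) : Prop :=
  ∀ x, TensorProduct.map (L.bracket x) L.phi s + TensorProduct.map L.phi (L.bracket x) s = 0

/-- `r = Λ + S` is a quasi-triangular hom-`r`-matrix. -/
structure IsQuasiTriangular (r : h ⊗[ℝ] h) : Prop where
  map_phi : TensorProduct.map L.phi L.phi r = r
  invariant : L.IsHomAdInvariant (symmPart r)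
  hcybe : L.hcyb r = 0

/-- For `r = ∑ xᵢ ⊗ yᵢ`, the map `r^♯ : h* → h`, `r^♯(ξ) = ∑ ⟨φ* ξ, xᵢ⟩ yᵢ`. -/
def sharp (r : h ⊗[ℝ] h) (ξ : Module.Dual ℝ h) : h :=
  TensorProduct.lid ℝ h (LinearMap.rTensor h (ξ ∘ₗ L.phi) r)

end HomLieAlgebra

end Tensors

/-! ### Functions, vector fields, and sections of the pullback `φ^! TM` -/

section Geometry

variable {n : ℕ} {M : Type*} [TopologicalSpace M] [ChartedSpace (EuclideanSpace ℝ (Fin n)) M]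

/-- The algebra `C^∞(M)`. -/
abbrev SmoothFun (n : ℕ) (M : Type*) [TopologicalSpace M]
    [ChartedSpace (EuclideanSpace ℝ (Fin n)) M] : Type _ :=
  C^∞⟮𝓡 n, M; 𝓘(ℝ, ℝ), ℝ⟯

/-- The pullback of functions `φ* : C^∞(M) → C^∞(M)`, `φ* f = f ∘ φ`. -/
def pullback (φ : M ≃ₘ^∞⟮𝓡 n, 𝓡 n⟯ M) : SmoothFun n M ≃ₐ[ℝ] SmoothFun n M where
  toFun f := ⟨fun p => f (φ p), f.contMDiff.comp φ.contMDiff⟩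
  invFun f := ⟨fun p => f (φ.symm p), f.contMDiff.comp φ.symm.contMDiff⟩
  left_inv f := by ext p; simp
  right_inv f := by ext p; simp
  map_mul' f g := by ext p; rfl
  map_add' f g := by ext p; rfl
  commutes' c := by ext p; rfl

/-- `Ad_{φ*}(x) = φ* ∘ x ∘ (φ*)⁻¹`. -/
def Ad (φ : M ≃ₘ^∞⟮𝓡 n, 𝓡 n⟯ M) (x : SmoothFun n M →ₗ[ℝ] SmoothFun n M) :
    SmoothFun n M →ₗ[ℝ] SmoothFun n M :=
  (pullback φ).toLinearMap ∘ₗ x ∘ₗ (pullback φ).symm.toLinearMap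

/-- `[x, y]_{φ*} = φ* ∘ x ∘ (φ*)⁻¹ ∘ y ∘ (φ*)⁻¹ - φ* ∘ y ∘ (φ*)⁻¹ ∘ x ∘ (φ*)⁻¹`. -/
def opBracket (φ : M ≃ₘ^∞⟮𝓡 n, 𝓡 n⟯ M) (x y : SmoothFun n M →ₗ[ℝ] SmoothFun n M) :
    SmoothFun n M →ₗ[ℝ] SmoothFun n M :=
  (pullback φ).toLinearMap ∘ₗ x ∘ₗ (pullback φ).symm.toLinearMap ∘ₗ y ∘ₗ
      (pullback φ).symm.toLinearMap
    - (pullback φ).toLinearMap ∘ₗ y ∘ₗ (pullback φ).symm.toLinearMap ∘ₗ x ∘ₗ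
      (pullback φ).symm.toLinearMap

/-- The skew bilinear operator `(f, g) ↦ (x ∧ y)(df, dg) = x(f) y(g) - y(f) x(g)`. -/
def wedge₂ (x y : SmoothFun n M →ₗ[ℝ] SmoothFun n M) :
    SmoothFun n M → SmoothFun n M → SmoothFun n M :=
  fun f g => x f * y g - y f * x g

/-- The skew trilinear operator `(f, g, k) ↦ (x ∧ y ∧ z)(df, dg, dk)`. -/
def wedge₃ (x y z : SmoothFun n M →ₗ[ℝ] SmoothFun n M) :
    SmoothFun n M → SmoothFun n M → SmoothFun n M → SmoothFun n M :=
  fun f g k => Matrix.det !![x f, x g, x k; y f, y g, y k; z f, z g, z k]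

variable [IsManifold (𝓡 n) ∞ M]

/-- Smooth vector fields on `M`. -/
abbrev VectorFields (n : ℕ) (M : Type*) [TopologicalSpace M]
    [ChartedSpace (EuclideanSpace ℝ (Fin n)) M] [IsManifold (𝓡 n) ∞ M] : Type _ :=
  Cₛ^∞⟮𝓡 n; EuclideanSpace ℝ (Fin n), (TangentSpace (𝓡 n) : M → Type _)⟯

theorem contMDiff_deriv (X : VectorFields n M) (f : SmoothFun n M) :
    ContMDiff (𝓡 n) 𝓘(ℝ, ℝ) ∞ (fun p => (mfderiv (𝓡 n) 𝓘(ℝ, ℝ) f p (X p) : ℝ)) := by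
  have h1 := f.contMDiff.contMDiff_tangentMap (m := ∞) (by simp)
  have h2 := h1.comp X.contMDiff
  exact (contMDiff_snd_tangentBundle_modelSpace ℝ 𝓘(ℝ, ℝ)).comp h2

/-- The action of vector fields on functions: `X(f) = df(X)`. -/
def lieDeriv : VectorFields n M →ₗ[ℝ] (SmoothFun n M →ₗ[ℝ] SmoothFun n M) :=
  LinearMap.mk₂ ℝ
    (fun X f => ⟨fun p => (mfderiv (𝓡 n) 𝓘(ℝ, ℝ) f p (X p) : ℝ), contMDiff_deriv X f⟩)
    (fun X Y f => by ext p; exact (mfderiv (𝓡 n) 𝓘(ℝ, ℝ) f p).map_add (X p) (Y p))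
    (fun c X f => by ext p; exact (mfderiv (𝓡 n) 𝓘(ℝ, ℝ) f p).map_smul c (X p))
    (fun X f g => by
      ext p
      have hf : MDifferentiableAt (𝓡 n) 𝓘(ℝ, ℝ) f p := f.contMDiff.mdifferentiable (by simp) p
      have hg : MDifferentiableAt (𝓡 n) 𝓘(ℝ, ℝ) g p := g.contMDiff.mdifferentiable (by simp) p
      exact congrArg (fun T => T (X p)) (hf.hasMFDerivAt.add hg.hasMFDerivAt).mfderiv)
    (fun c X f => by
      ext p
      have hf : MDifferentiableAt (𝓡 n) 𝓘(ℝ, ℝ) f p := f.contMDiff.mdifferentiable (by simp) p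
      exact congrArg (fun T => T (X p)) (hf.hasMFDerivAt.const_smul c).mfderiv)

theorem lieDeriv_mul (X : VectorFields n M) (f g : SmoothFun n M) :
    lieDeriv X (f * g) = lieDeriv X f * g + f * lieDeriv X g := by
  ext p
  have hf : MDifferentiableAt (𝓡 n) 𝓘(ℝ, ℝ) f p := f.contMDiff.mdifferentiable (by simp) p
  have hg : MDifferentiableAt (𝓡 n) 𝓘(ℝ, ℝ) g p := g.contMDiff.mdifferentiable (by simp) p
  have h := congrArg (fun T => T (X p)) (hf.hasMFDerivAt.mul hg.hasMFDerivAt).mfderiv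
  refine h.trans ?_
  change f p * lieDeriv X g p + g p * lieDeriv X f p = lieDeriv X f p * g p + f p * lieDeriv X g p
  ring

/-- `Γ(φ^! TM)`: the sections `p ↦ x(p) ∈ T_{φ(p)} M` of the form `x = X ∘ φ` with `X` a smooth
vector field on `M`. -/
def SectionsAlong (φ : M ≃ₘ^∞⟮𝓡 n, 𝓡 n⟯ M) :
    Submodule ℝ (∀ p : M, TangentSpace (𝓡 n) (φ p)) where
  carrier := {x | ∃ X : VectorFields n M, ∀ p, x p = X (φ p)}
  add_mem' := by
    rintro x y ⟨X, hX⟩ ⟨Y, hY⟩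
    exact ⟨X + Y, fun p => by simp [hX, hY]⟩
  zero_mem' := ⟨0, fun p => by simp⟩
  smul_mem' := by
    rintro c x ⟨X, hX⟩
    exact ⟨c • X, fun p => by simp [hX]⟩

/-- The action of `x ∈ Γ(φ^! TM)` on functions: `x(f)(p) = df_{φ(p)}(x(p))`. -/
def sectionDeriv (φ : M ≃ₘ^∞⟮𝓡 n, 𝓡 n⟯ M) :
    SectionsAlong φ →ₗ[ℝ] (SmoothFun n M →ₗ[ℝ] SmoothFun n M) :=
  LinearMap.mk₂ ℝ
    (fun x f => ⟨fun p => (mfderiv (𝓡 n) 𝓘(ℝ, ℝ) f (φ p) (x.1 p) : ℝ), by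
      obtain ⟨X, hX⟩ := x.2
      simp only [hX]
      exact (contMDiff_deriv X f).comp φ.contMDiff⟩)
    (fun x y f => by ext p; exact (mfderiv (𝓡 n) 𝓘(ℝ, ℝ) f (φ p)).map_add (x.1 p) (y.1 p))
    (fun c x f => by ext p; exact (mfderiv (𝓡 n) 𝓘(ℝ, ℝ) f (φ p)).map_smul c (x.1 p))
    (fun x f g => by
      obtain ⟨X, hX⟩ := x.2
      ext p
      simp only [hX]
      exact DFunLike.congr_fun ((lieDeriv X).map_add f g) (φ p))
    (fun c x f => by
      obtain ⟨X, hX⟩ := x.2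
      ext p
      simp only [hX]
      exact DFunLike.congr_fun ((lieDeriv X).map_smul c f) (φ p))

/-- `x(f g) = x(f) φ*(g) + φ*(f) x(g)` for `x ∈ Γ(φ^! TM)`. -/
theorem sectionDeriv_mul (φ : M ≃ₘ^∞⟮𝓡 n, 𝓡 n⟯ M) (x : SectionsAlong φ) (f g : SmoothFun n M) :
    sectionDeriv φ x (f * g)
      = sectionDeriv φ x f * pullback φ g + pullback φ f * sectionDeriv φ x g := by
  obtain ⟨X, hX⟩ := x.2
  have key : ∀ f, sectionDeriv φ x f = pullback φ (lieDeriv X f) := by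
    intro f
    ext p
    change (mfderiv (𝓡 n) 𝓘(ℝ, ℝ) f (φ p) (x.1 p) : ℝ) = _
    rw [hX]
    rfl
  simp only [key, lieDeriv_mul, map_add, map_mul]

/-! ### Bisections, the hom-Schouten bracket, hom-Poisson and Poisson structures

A contravariant tensor field is represented by its values on differentials of functions. -/

/-- `∧² Γ(φ^! TM)`: finite sums of `x ∧ y` with `x, y ∈ Γ(φ^! TM)`. -/
def Bisections (φ : M ≃ₘ^∞⟮𝓡 n, 𝓡 n⟯ M) :
    Submodule ℝ (SmoothFun n M → SmoothFun n M → SmoothFun n M) :=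
  Submodule.span ℝ
    {π | ∃ x y : SectionsAlong φ, π = wedge₂ (sectionDeriv φ x) (sectionDeriv φ y)}

/-- The bisection `x ∧ y`. -/
def Bisections.wedge {φ : M ≃ₘ^∞⟮𝓡 n, 𝓡 n⟯ M} (x y : SectionsAlong φ) : Bisections φ :=
  ⟨wedge₂ (sectionDeriv φ x) (sectionDeriv φ y), Submodule.subset_span ⟨x, y, rfl⟩⟩

theorem Bisections.map_add_left {φ : M ≃ₘ^∞⟮𝓡 n, 𝓡 n⟯ M} (π : Bisections φ)
    (f g k : SmoothFun n M) : π.1 (f + g) k = π.1 f k + π.1 g k := by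
  obtain ⟨π, hπ⟩ := π
  induction hπ using Submodule.span_induction with
  | mem π h =>
    obtain ⟨x, y, rfl⟩ := h
    simp only [wedge₂, map_add]
    ring
  | zero => simp
  | add π ρ _ _ h1 h2 =>
    simp only [Pi.add_apply] at h1 h2 ⊢
    rw [h1, h2]
    abel
  | smul c π _ h =>
    simp only [Pi.smul_apply] at h ⊢
    rw [h, smul_add]

theorem Bisections.map_smul_left {φ : M ≃ₘ^∞⟮𝓡 n, 𝓡 n⟯ M} (π : Bisections φ)
    (c : ℝ) (f k : SmoothFun n M) : π.1 (c • f) k = c • π.1 f k := by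
  obtain ⟨π, hπ⟩ := π
  induction hπ using Submodule.span_induction with
  | mem π h =>
    obtain ⟨x, y, rfl⟩ := h
    simp only [wedge₂, map_smul, smul_mul_assoc, smul_sub]
  | zero => simp
  | add π ρ _ _ h1 h2 =>
    simp only [Pi.add_apply] at h1 h2 ⊢
    rw [h1, h2, smul_add]
  | smul d π _ h =>
    simp only [Pi.smul_apply] at h ⊢
    rw [h, smul_comm]

/-- The value of the hom-Schouten bracket `[[x ∧ y, z ∧ w]]` prescribed by the graded
skew-symmetry and the hom-Leibniz rule:
`[x,z] ∧ Ad y ∧ Ad w - [x,w] ∧ Ad y ∧ Ad z - [y,z] ∧ Ad x ∧ Ad w + [y,w] ∧ Ad x ∧ Ad z`. -/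
def schoutenWedge (φ : M ≃ₘ^∞⟮𝓡 n, 𝓡 n⟯ M) (x y z w : SmoothFun n M →ₗ[ℝ] SmoothFun n M) :
    SmoothFun n M → SmoothFun n M → SmoothFun n M → SmoothFun n M :=
  wedge₃ (opBracket φ x z) (Ad φ y) (Ad φ w) - wedge₃ (opBracket φ x w) (Ad φ y) (Ad φ z)
    - wedge₃ (opBracket φ y z) (Ad φ x) (Ad φ w) + wedge₃ (opBracket φ y w) (Ad φ x) (Ad φ z)

/-- The hom-Schouten bracket on `∧² Γ(φ^! TM)` is well defined: there is exactly one bilinear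
operation with the prescribed values on the decomposable bisections. -/
theorem existsUnique_homSchouten (φ : M ≃ₘ^∞⟮𝓡 n, 𝓡 n⟯ M) :
    ∃! B : Bisections φ →ₗ[ℝ] Bisections φ →ₗ[ℝ]
        (SmoothFun n M → SmoothFun n M → SmoothFun n M → SmoothFun n M),
      ∀ x y z w : SectionsAlong φ, B (Bisections.wedge x y) (Bisections.wedge z w) =
        schoutenWedge φ (sectionDeriv φ x) (sectionDeriv φ y)
          (sectionDeriv φ z) (sectionDeriv φ w) := by
  let τ := pullback φ
  let T : Bisections φ → Bisections φ → SmoothFun n M → SmoothFun n M → SmoothFun n M →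
      SmoothFun n M := fun π ρ f g k =>
    π.1 (τ.symm (ρ.1 f g)) k + π.1 (τ.symm (ρ.1 g k)) f + π.1 (τ.symm (ρ.1 k f)) g
  have T1 : ∀ π π' ρ f g k, T (π + π') ρ f g k = T π ρ f g k + T π' ρ f g k := by
    intro π π' ρ f g k
    simp only [T, Submodule.coe_add, Pi.add_apply]
    abel
  have T2 : ∀ (c : ℝ) π ρ f g k, T (c • π) ρ f g k = c • T π ρ f g k := by
    intro c π ρ f g k
    simp only [T, Submodule.coe_smul, Pi.smul_apply, smul_add]
  have T3 : ∀ π ρ ρ' f g k, T π (ρ + ρ') f g k = T π ρ f g k + T π ρ' f g k := by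
    intro π ρ ρ' f g k
    simp only [T, Submodule.coe_add, Pi.add_apply, map_add, Bisections.map_add_left]
    abel
  have T4 : ∀ (c : ℝ) π ρ f g k, T π (c • ρ) f g k = c • T π ρ f g k := by
    intro c π ρ f g k
    simp only [T, Submodule.coe_smul, Pi.smul_apply, map_smul, Bisections.map_smul_left, smul_add]
  let B₀ : Bisections φ →ₗ[ℝ] Bisections φ →ₗ[ℝ]
      (SmoothFun n M → SmoothFun n M → SmoothFun n M → SmoothFun n M) :=
    LinearMap.mk₂ ℝ (fun π ρ f g k => -τ (T π ρ (τ.symm f) (τ.symm g) (τ.symm k)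
      + T ρ π (τ.symm f) (τ.symm g) (τ.symm k))) ?_ ?_ ?_ ?_
  have hB₀ : ∀ x y z w : SectionsAlong φ, B₀ (Bisections.wedge x y) (Bisections.wedge z w) =
      schoutenWedge φ (sectionDeriv φ x) (sectionDeriv φ y)
        (sectionDeriv φ z) (sectionDeriv φ w) := by
    intro x y z w
    funext f g k
    simp only [B₀, LinearMap.mk₂_apply, T, Bisections.wedge, wedge₂, schoutenWedge, wedge₃,
      opBracket, Ad, Matrix.det_fin_three, Pi.add_apply, Pi.sub_apply, LinearMap.sub_apply,
      LinearMap.comp_apply, AlgEquiv.toLinearMap_apply, map_add, map_sub, map_mul,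
      sectionDeriv_mul, AlgEquiv.apply_symm_apply, Matrix.of_apply, Matrix.cons_val',
      Matrix.cons_val_zero, Matrix.cons_val_one, Matrix.cons_val, τ]
    ring
  · refine ⟨B₀, hB₀, ?_⟩
    intro B hB
    have hB' : ∀ π ρ : Bisections φ, B π ρ = B₀ π ρ := by
      rintro ⟨π, hπ⟩ ⟨ρ, hρ⟩
      induction hπ using Submodule.span_induction with
      | mem π h =>
        obtain ⟨x, y, rfl⟩ := h
        induction hρ using Submodule.span_induction with
        | mem ρ h =>
          obtain ⟨z, w, rfl⟩ := h
          exact (hB x y z w).trans (hB₀ x y z w).symm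
        | zero => exact ((B _).map_zero).trans ((B₀ _).map_zero).symm
        | add ρ ρ' h1 h2 e1 e2 =>
          have e := congrArg₂ (· + ·) e1 e2
          simp only [← map_add] at e
          exact e
        | smul c ρ h e =>
          have e' := congrArg (c • ·) e
          simp only [← map_smul] at e'
          exact e'
      | zero =>
        exact (LinearMap.congr_fun B.map_zero _).trans (LinearMap.congr_fun B₀.map_zero _).symm
      | add π π' h1 h2 e1 e2 =>
        have e := congrArg₂ (· + ·) e1 e2
        simp only [← LinearMap.add_apply, ← map_add] at e
        exact e
      | smul c π h e =>
        have e' := congrArg (c • ·) e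
        exact (B.map_smul₂ c ⟨π, h⟩ ⟨ρ, hρ⟩).trans (e'.trans (B₀.map_smul₂ c ⟨π, h⟩ ⟨ρ, hρ⟩).symm)
    exact LinearMap.ext fun π => LinearMap.ext fun ρ => hB' π ρ
  · intro π π' ρ
    funext f g k
    simp only [T1, T3, Pi.add_apply, map_add]
    abel
  · intro c π ρ
    funext f g k
    simp only [T2, T4, Pi.smul_apply, map_add, map_smul, smul_add, smul_neg]
  · intro π ρ ρ'
    funext f g k
    simp only [T1, T3, Pi.add_apply, map_add]
    abel
  · intro c π ρ
    funext f g k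
    simp only [T2, T4, Pi.smul_apply, map_add, map_smul, smul_add, smul_neg]

/-- The hom-Schouten bracket `[[·,·]] : ∧² Γ(φ^! TM) × ∧² Γ(φ^! TM) → ∧³ Γ(φ^! TM)`. -/
def homSchouten (φ : M ≃ₘ^∞⟮𝓡 n, 𝓡 n⟯ M) : Bisections φ →ₗ[ℝ] Bisections φ →ₗ[ℝ]
    (SmoothFun n M → SmoothFun n M → SmoothFun n M → SmoothFun n M) :=
  (existsUnique_homSchouten φ).choose

theorem homSchouten_wedge (φ : M ≃ₘ^∞⟮𝓡 n, 𝓡 n⟯ M) (x y z w : SectionsAlong φ) :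
    homSchouten φ (Bisections.wedge x y) (Bisections.wedge z w) =
      schoutenWedge φ (sectionDeriv φ x) (sectionDeriv φ y)
        (sectionDeriv φ z) (sectionDeriv φ w) :=
  (existsUnique_homSchouten φ).choose_spec.1 x y z w

/-- `π` is a hom-Poisson tensor, i.e. `(M, φ, π)` is a hom-Poisson structure: `π` belongs to
`∧² Γ(φ^! TM)`, `[[π, π]] = 0` and `Ad_{φ*}(π) = π`. -/
def IsHomPoisson (φ : M ≃ₘ^∞⟮𝓡 n, 𝓡 n⟯ M)
    (π : SmoothFun n M → SmoothFun n M → SmoothFun n M) : Prop :=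
  (∃ hπ : π ∈ Bisections φ, homSchouten φ ⟨π, hπ⟩ ⟨π, hπ⟩ = 0) ∧
    ∀ f g, pullback φ (π ((pullback φ).symm f) ((pullback φ).symm g)) = π f g

/-- `π` is a Poisson structure on `M`: it is a smooth bivector field (a finite sum of `X ∧ Y` with
`X`, `Y` smooth vector fields) such that `{f, g} = π(df, dg)` satisfies the Jacobi identity. -/
def IsPoisson (π : SmoothFun n M → SmoothFun n M → SmoothFun n M) : Prop :=
  π ∈ Submodule.span ℝ {ρ | ∃ X Y : VectorFields n M, ρ = wedge₂ (lieDeriv X) (lieDeriv Y)} ∧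
    ∀ f g k, π f (π g k) + π g (π k f) + π k (π f g) = 0

/-! ### Actions, stabilizers, and the tensor fields `σ(r)` -/

section Actions

variable {h : Type*} [AddCommGroup h] [Module ℝ h]

/-- An action of the hom-Lie algebra `(h, L)` on `M` along the diffeomorphism `φ`. -/
structure IsHomAction (L : HomLieAlgebra h) (φ : M ≃ₘ^∞⟮𝓡 n, 𝓡 n⟯ M)
    (σ : h →ₗ[ℝ] SectionsAlong φ) : Prop where
  map_phi : ∀ x, sectionDeriv φ (σ (L.phi x)) = Ad φ (sectionDeriv φ (σ x))
  map_bracket : ∀ x y, sectionDeriv φ (σ (L.bracket x y))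
    = opBracket φ (sectionDeriv φ (σ x)) (sectionDeriv φ (σ y))

/-- An action of a Lie algebra on `M`: a linear map `σ` to vector fields with
`σ [x, y] = [σ x, σ y]`. -/
def IsLieAction {g : Type*} [LieRing g] [LieAlgebra ℝ g] (σ : g →ₗ[ℝ] VectorFields n M) : Prop :=
  ∀ (x y : g) (f : SmoothFun n M), lieDeriv (σ ⁅x, y⁆) f
    = lieDeriv (σ x) (lieDeriv (σ y) f) - lieDeriv (σ y) (lieDeriv (σ x) f)

/-- `q_p = {a | σ(a)(p) = 0}`, where `σ(a)(p) ∈ T_{φ(p)} M`. -/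
def homStabilizer {φ : M ≃ₘ^∞⟮𝓡 n, 𝓡 n⟯ M} (σ : h →ₗ[ℝ] SectionsAlong φ) (p : M) :
    Submodule ℝ h where
  carrier := {a | (σ a).1 p = 0}
  add_mem' {a b} ha hb := by
    simp only [Set.mem_ofPred_eq] at ha hb ⊢
    simp [ha, hb]
  zero_mem' := by simp
  smul_mem' c a ha := by
    simp only [Set.mem_ofPred_eq] at ha ⊢
    simp [ha]

/-- `q_p = {a | σ(a)(p) = 0}`, where `σ(a)(p) ∈ T_p M`. -/
def stabilizer (σ : h →ₗ[ℝ] VectorFields n M) (p : M) : Submodule ℝ h where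
  carrier := {a | σ a p = 0}
  add_mem' {a b} ha hb := by
    simp only [Set.mem_ofPred_eq] at ha hb ⊢
    simp [ha, hb]
  zero_mem' := by simp
  smul_mem' c a ha := by
    simp only [Set.mem_ofPred_eq] at ha ⊢
    simp [ha]

/-- For a linear map `D` to operators on functions and `r = ∑ xᵢ ⊗ yᵢ`, the bilinear operator
`(f, g) ↦ ∑ D(xᵢ)(f) D(yᵢ)(g)`. -/
def tensorOp (D : h →ₗ[ℝ] (SmoothFun n M →ₗ[ℝ] SmoothFun n M)) (r : h ⊗[ℝ] h) :
    SmoothFun n M → SmoothFun n M → SmoothFun n M :=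
  fun f g => LinearMap.mul' ℝ (SmoothFun n M) (TensorProduct.map (D.flip f) (D.flip g) r)

/-- `σ(r) = ∑ σ(xᵢ) ⊗ σ(yᵢ)` for `r = ∑ xᵢ ⊗ yᵢ` and `σ : h → Γ(φ^! TM)`. -/
def homSigma {φ : M ≃ₘ^∞⟮𝓡 n, 𝓡 n⟯ M} (σ : h →ₗ[ℝ] SectionsAlong φ) (r : h ⊗[ℝ] h) :
    SmoothFun n M → SmoothFun n M → SmoothFun n M :=
  tensorOp (sectionDeriv φ ∘ₗ σ) r

/-- `σ(r) = ∑ σ(xᵢ) ⊗ σ(yᵢ)` for `r = ∑ xᵢ ⊗ yᵢ` and `σ : h → Γ(TM)`. -/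
def sigma (σ : h →ₗ[ℝ] VectorFields n M) (r : h ⊗[ℝ] h) :
    SmoothFun n M → SmoothFun n M → SmoothFun n M :=
  tensorOp (lieDeriv ∘ₗ σ) r

end Actions

end Geometry

/-! ### Manin triples -/

/-- A Manin triple `((d, ⟨,⟩), g₁, g₂)`: a quadratic Lie algebra which is the direct sum of two
isotropic Lie subalgebras (these are then Lagrangian). -/
structure ManinTriple (d : Type*) [LieRing d] [LieAlgebra ℝ d] where
  form : LinearMap.BilinForm ℝ d
  symm : ∀ a b, form a b = form b a
  nondegenerate : ∀ a, (∀ b, form a b = 0) → a = 0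
  invariant : ∀ a b c, form ⁅a, b⁆ c = form a ⁅b, c⁆
  g₁ : LieSubalgebra ℝ d
  g₂ : LieSubalgebra ℝ d
  isotropic₁ : ∀ a ∈ g₁, ∀ b ∈ g₁, form a b = 0
  isotropic₂ : ∀ a ∈ g₂, ∀ b ∈ g₂, form a b = 0
  isCompl : IsCompl g₁.toSubmodule g₂.toSubmodule

end HomPoisson

end

noncomputable section

namespace HomPoisson

/-! ### Covectors are differentials of functions -/

section Covectors

variable {n : ℕ} {M : Type*} [TopologicalSpace M] [ChartedSpace (EuclideanSpace ℝ (Fin n)) M]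
  [IsManifold (𝓡 n) ∞ M]

/-! Everything rests on one pointwise identity for ordinary Lie algebra actions. Put `{f, g} =
σ(Λ)(df, dg)`. Because `Λ` is skew, the Jacobi sum of this bracket is the Yang-Baxter expression of
`Λ` pushed forward by `σ` and evaluated on `f, g, k` (`jacobiator_of_skew`). In the Yang-Baxter
equation for `r = Λ + S`, invariance of `S` and skewness of `Λ` cancel all mixed terms and two of
the three pure `S` terms, so the expression for `Λ` equals `-∑ sᵢ ⊗ sⱼ ⊗ [tᵢ, tⱼ]`
(`tripleEval_cyb_skew`). Hence the Jacobi sum at `m` is `-(σ[S^♯ ξ, S^♯ η] k)(m)`, where `ξ`, `η`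
are the covectors `a ↦ (σ(a) f)(m)` and `a ↦ (σ(a) g)(m)` (`jacobiator_sigma_skewPart_apply`). As
`f` varies these covectors fill out `q_m^⊥` (`exists_actionCovector_eq`), and a tangent vector
killing all functions is zero; this gives the criterion for Lie algebras.

An involutive hom-Lie algebra reduces to this case. The bracket `φ ∘ [·,·]` is a Lie bracket with
the same quasi-triangular `r`, and writing `σ(a) = X_a ∘ φ` makes `a ↦ X_a` an ordinary action of it
(`preservesBracket_untwist`). The hom-Schouten square becomes twice the Jacobi sum, pulled back
twice. When `S^♯(q^⊥) ⊂ q` and `φ(q) ⊂ q`, one gets `σ(S) = 0`, so `σ(r) = σ(Λ)`, and the criterion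
holds because stabilizers are closed under the Lie bracket.

For a Manin triple, `S` is half the Casimir element of the form, so `S^♯` is half the identification
of the dual with `d`, and the criterion becomes a condition on orthogonals. -/

theorem lieDeriv_apply (X : VectorFields n M) (f : SmoothFun n M) (p : M) :
    lieDeriv X f p = (mfderiv (𝓡 n) 𝓘(ℝ, ℝ) f p (X p) : ℝ) := rfl

/-- The function is `α` in the chart at `m`, cut off by a bump function equal to `1` near `m`. Since
`T_m M` is modelled through that same chart, the chart has identity derivative at `m`. -/
theorem exists_smoothFun_mfderiv_eq [T2Space M] (m : M)
    (α : EuclideanSpace ℝ (Fin n) →ₗ[ℝ] ℝ) :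
    ∃ f : SmoothFun n M, ∀ v : TangentSpace (𝓡 n) m,
      (mfderiv (𝓡 n) 𝓘(ℝ, ℝ) f m v : ℝ) = α v := by
  obtain ⟨β⟩ : Nonempty (SmoothBumpFunction (𝓡 n) m) := inferInstance
  let A : EuclideanSpace ℝ (Fin n) →L[ℝ] ℝ := LinearMap.toContinuousLinearMap α
  have hs : ContMDiffOn (𝓡 n) 𝓘(ℝ, ℝ) ∞ (fun x => A (extChartAt (𝓡 n) m x))
      (chartAt (EuclideanSpace ℝ (Fin n)) m).source :=
    A.contMDiff.comp_contMDiffOn contMDiffOn_extChartAt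
  let f : SmoothFun n M := ⟨fun x => β x • A (extChartAt (𝓡 n) m x), β.contMDiff_smul hs⟩
  refine ⟨f, fun v => ?_⟩
  have hev : (f : M → ℝ) =ᶠ[nhds m] A ∘ extChartAt (𝓡 n) m := by
    filter_upwards [β.eventuallyEq_one] with x hx
    change β x • A (extChartAt (𝓡 n) m x) = _
    simp [hx]
  rw [hev.mfderiv_eq]
  have h1 : MDifferentiableAt (𝓡 n) 𝓘(ℝ, EuclideanSpace ℝ (Fin n)) (extChartAt (𝓡 n) m) m :=
    (contMDiffAt_extChartAt (n := 1)).mdifferentiableAt (by simp)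
  rw [mfderiv_comp m A.differentiableAt.mdifferentiableAt h1, mfderiv_extChartAt_self,
    mfderiv_eq_fderiv, A.fderiv]
  rfl

theorem eq_zero_of_forall_lieDeriv [T2Space M] (X : VectorFields n M) (m : M)
    (hX : ∀ f : SmoothFun n M, lieDeriv X f m = 0) : X m = 0 := by
  refine (Module.forall_dual_apply_eq_zero_iff ℝ (X m : EuclideanSpace ℝ (Fin n))).1 fun α => ?_
  obtain ⟨f, hf⟩ := exists_smoothFun_mfderiv_eq m α
  exact (hf (X m)).symm.trans (hX f)

variable {h : Type*} [AddCommGroup h] [Module ℝ h]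

theorem mem_stabilizer_iff [T2Space M] (σ : h →ₗ[ℝ] VectorFields n M) (m : M) (a : h) :
    a ∈ stabilizer σ m ↔ ∀ f : SmoothFun n M, lieDeriv (σ a) f m = 0 := by
  refine ⟨fun ha f => ?_, eq_zero_of_forall_lieDeriv _ m⟩
  rw [lieDeriv_apply, show σ a m = 0 from ha]
  exact map_zero _

/-- The covector `a ↦ (σ(a) f)(m)`. -/
def actionCovector (σ : h →ₗ[ℝ] VectorFields n M) (m : M) (f : SmoothFun n M) :
    Module.Dual ℝ h where
  toFun a := lieDeriv (σ a) f m
  map_add' a b := by simp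
  map_smul' c a := by simp

theorem actionCovector_mem (σ : h →ₗ[ℝ] VectorFields n M) (m : M) (f : SmoothFun n M) :
    actionCovector σ m f ∈ (stabilizer σ m).dualAnnihilator := by
  rw [Submodule.mem_dualAnnihilator]
  intro a ha
  change lieDeriv (σ a) f m = 0
  rw [lieDeriv_apply, show σ a m = 0 from ha]
  exact map_zero _

/-- A functional vanishing on the kernel of `a ↦ σ(a)(m)` factors through this map, hence comes from
a covector at `m`, which is the differential of a function. No finiteness of `h` is needed. -/
theorem exists_actionCovector_eq [T2Space M] (σ : h →ₗ[ℝ] VectorFields n M) (m : M)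
    {ξ : Module.Dual ℝ h} (hξ : ξ ∈ (stabilizer σ m).dualAnnihilator) :
    ∃ f : SmoothFun n M, ξ = actionCovector σ m f := by
  let ev : h →ₗ[ℝ] EuclideanSpace ℝ (Fin n) :=
    { toFun := fun a => σ a m
      map_add' := fun a b => by simp; rfl
      map_smul' := fun c a => by simp; rfl }
  have hker : LinearMap.ker ev = stabilizer σ m := by
    ext a
    exact Iff.rfl
  rw [← hker, ← LinearMap.range_dualMap_eq_dualAnnihilator_ker] at hξ
  obtain ⟨α, rfl⟩ := hξ
  obtain ⟨f, hf⟩ := exists_smoothFun_mfderiv_eq m α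
  refine ⟨f, LinearMap.ext fun a => ?_⟩
  exact (hf (σ a m)).symm

end Covectors

/-! ### The classical Yang-Baxter equation and the Jacobi identity -/

section Algebra

variable {A : Type*} [CommRing A] [Algebra ℝ A]

/-- Purely algebraic: `B` is a skew biderivation given by some presentation, and skewness moves
every outer bracket so that the second-order terms pair into commutators. -/
theorem jacobiator_of_skew {ι : Type*} [Fintype ι] (a b : ι → A →ₗ[ℝ] A)
    (ha : ∀ i f g, a i (f * g) = a i f * g + f * a i g)
    (hb : ∀ i f g, b i (f * g) = b i f * g + f * b i g)
    (B : A → A → A) (hB : ∀ f g, B f g = ∑ i, a i f * b i g)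
    (hskew : ∀ f g, B f g = -B g f) (f g k : A) :
    B f (B g k) + B g (B k f) + B k (B f g) = ∑ i, ∑ j,
      ((a i (a j f) - a j (a i f)) * (b i g * b j k)
        + a i f * ((b i (a j g) - a j (b i g)) * b j k)
        + a i f * (a j g * (b i (b j k) - b j (b i k)))) := by
  have e1 : B f (B g k) = ∑ i, ∑ j, (a i f * (b i (a j g) * b j k)
      + a i f * (a j g * b i (b j k))) := by
    simp only [hB, map_sum, hb, Finset.mul_sum]
    exact Finset.sum_congr rfl fun i _ => Finset.sum_congr rfl fun j _ => by ring
  have e2 : B g (B k f) = -∑ i, ∑ j, (a i g * (b i (a j f) * b j k)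
      + a j g * (a i f * b j (b i k))) := by
    have hs : B g (B k f) = -∑ i, ∑ j, (a i g * (b i (a j f) * b j k)
      + a i g * (a j f * b i (b j k))) := by
      rw [hskew k f, hB]
      simp only [hB, map_neg, map_sum, hb, Finset.mul_sum, mul_neg, Finset.sum_neg_distrib]
      congr 1
      exact Finset.sum_congr rfl fun i _ => Finset.sum_congr rfl fun j _ => by ring
    rw [hs]
    simp only [Finset.sum_add_distrib]
    congr 2
    exact Finset.sum_comm
  have e3 : B k (B f g) = -∑ i, ∑ j, (a j (a i f) * (b i g * b j k)
      + a i f * (a j (b i g) * b j k)) := by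
    rw [hskew k, hB, Finset.sum_comm]
    simp only [hB, map_sum, ha, Finset.sum_mul]
    congr 1
    exact Finset.sum_congr rfl fun i _ => Finset.sum_congr rfl fun j _ => by ring
  -- Skewness of `B` on the pair `(a j f, g)`. Adding this zero trades the stray term of `e2`
  -- containing `b i (a j f)` for the missing half of the commutator `[a i, a j] f`.
  have e4 : ∑ i, ∑ j, (a i (a j f) * (b i g * b j k) + a i g * (b i (a j f) * b j k)) = 0 := by
    rw [Finset.sum_comm]
    refine Finset.sum_eq_zero fun j _ => ?_
    have h1 := hskew (a j f) g
    rw [hB, hB, eq_neg_iff_add_eq_zero, ← Finset.sum_add_distrib] at h1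
    calc _ = (∑ i, (a i (a j f) * b i g + a i g * b i (a j f))) * b j k := by
          rw [Finset.sum_mul]
          exact Finset.sum_congr rfl fun i _ => by ring
      _ = 0 := by rw [h1, zero_mul]
  rw [e1, e2, e3, ← add_zero (_ + _ + _), ← e4]
  simp only [← Finset.sum_neg_distrib, ← Finset.sum_add_distrib]
  exact Finset.sum_congr rfl fun i _ => Finset.sum_congr rfl fun j _ => by ring

variable {h : Type*} [AddCommGroup h] [Module ℝ h]

/-- `u ⊗ v ⊗ w ↦ u(x) v(y) w(z)`. -/
def tripleEval (u v w : h →ₗ[ℝ] A) : h ⊗[ℝ] (h ⊗[ℝ] h) →ₗ[ℝ] A :=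
  LinearMap.mul' ℝ A ∘ₗ TensorProduct.map u (LinearMap.mul' ℝ A ∘ₗ TensorProduct.map v w)

theorem tripleEval_tmul (u v w : h →ₗ[ℝ] A) (x y z : h) :
    tripleEval u v w (x ⊗ₜ (y ⊗ₜ z)) = u x * (v y * w z) := by
  simp [tripleEval]

theorem HomLieAlgebra.bracket_skew (L : HomLieAlgebra h) (x y : h) :
    L.bracket x y = -L.bracket y x := by
  have e := L.bracket_self (x + y)
  simp only [map_add, LinearMap.add_apply, L.bracket_self, zero_add, add_zero] at e
  exact eq_neg_of_add_eq_zero_right e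

/-- The Yang-Baxter expression of the skew part alone, with the invariant part as its only
obstruction. The three functionals take values in `A` so that they can be `a ↦ σ(a) f` with values
in functions. -/
theorem tripleEval_cyb_skew (L : HomLieAlgebra h) (hL : L.phi = LinearMap.id)
    {ι κ : Type*} [Fintype ι] [Fintype κ] (a b : ι → h) (s t : κ → h)
    (hskew : ∑ i, a i ⊗ₜ[ℝ] b i = -∑ i, b i ⊗ₜ[ℝ] a i)
    (hinv : L.IsHomAdInvariant (∑ i, s i ⊗ₜ[ℝ] t i))
    (hcyb : L.hcyb (∑ i, a i ⊗ₜ[ℝ] b i + ∑ i, s i ⊗ₜ[ℝ] t i) = 0) (u v w : h →ₗ[ℝ] A) :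
    ∑ i, ∑ j, (u (L.bracket (a i) (a j)) * (v (b i) * w (b j))
      + u (a i) * (v (L.bracket (b i) (a j)) * w (b j))
      + u (a i) * (v (a j) * w (L.bracket (b i) (b j))))
    = -∑ i, ∑ j, u (s i) * (v (s j) * w (L.bracket (t i) (t j))) := by
  have inv : ∀ (p q : h →ₗ[ℝ] A) (x : h), ∑ j, p (L.bracket x (s j)) * q (t j)
      + ∑ j, p (s j) * q (L.bracket x (t j)) = 0 := by
    intro p q x
    have e := congrArg (LinearMap.mul' ℝ A ∘ₗ TensorProduct.map p q) (hinv x)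
    simpa [hL] using e
  have skew : ∀ (p q : h →ₗ[ℝ] A), ∑ i, p (a i) * q (b i) + ∑ i, p (b i) * q (a i) = 0 := by
    intro p q
    have e := congrArg (LinearMap.mul' ℝ A ∘ₗ TensorProduct.map p q) hskew
    rw [← eq_neg_iff_add_eq_zero]
    simpa using e
  -- A single presentation over the disjoint union of the index types, as `hcyb_sum` requires; its
  -- double sum splits into the four blocks `ΛΛ`, `ΛS`, `SΛ`, `SS`.
  have hsum : ∑ i, a i ⊗ₜ[ℝ] b i + ∑ i, s i ⊗ₜ[ℝ] t i
      = ∑ i, Sum.elim a s i ⊗ₜ[ℝ] Sum.elim b t i := by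
    simp [Fintype.sum_sum_type]
  rw [hsum, L.hcyb_sum] at hcyb
  have e := congrArg (tripleEval u v w) hcyb
  simp only [map_sum, map_add, tripleEval_tmul, hL, LinearMap.id_apply, Fintype.sum_sum_type,
    Sum.elim_inl, Sum.elim_inr, map_zero, Finset.sum_add_distrib] at e
  -- `ΛS` terms: invariance of `S` under `b i`. The `SΛ` terms in `c2` use invariance under `a i`.
  have c1 : ∑ i, ∑ j, u (a i) * (v (L.bracket (b i) (s j)) * w (t j))
      + ∑ i, ∑ j, u (a i) * (v (s j) * w (L.bracket (b i) (t j))) = 0 := by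
    simp only [← Finset.mul_sum, ← Finset.sum_add_distrib, ← mul_add, inv, mul_zero,
      Finset.sum_const_zero]
  have c2 : ∑ j, ∑ i, u (L.bracket (s j) (a i)) * (v (t j) * w (b i))
      + ∑ j, ∑ i, u (s j) * (v (L.bracket (t j) (a i)) * w (b i)) = 0 := by
    rw [Finset.sum_comm, Finset.sum_comm (f := fun j i => u (s j) * _),
      ← Finset.sum_add_distrib]
    refine Finset.sum_eq_zero fun i _ => ?_
    simp only [← mul_assoc, ← Finset.sum_mul, ← add_mul, L.bracket_skew _ (a i), map_neg,
      neg_mul, mul_neg, Finset.sum_neg_distrib, ← neg_add, inv, neg_zero, zero_mul]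
  -- The two mixed terms left over come from different blocks; skewness of `Λ` exchanges `a i` and
  -- `b i` in the first, after which invariance under `b i` applies.
  have c3 : ∑ i, ∑ j, u (L.bracket (a i) (s j)) * (v (b i) * w (t j))
      + ∑ j, ∑ i, u (s j) * (v (a i) * w (L.bracket (t j) (b i))) = 0 := by
    have d1 : ∑ i, ∑ j, u (L.bracket (a i) (s j)) * (v (b i) * w (t j))
        = -∑ i, ∑ j, u (L.bracket (b i) (s j)) * (v (a i) * w (t j)) := by
      rw [Finset.sum_comm, Finset.sum_comm (f := fun i j => u (L.bracket (b i) (s j)) * _),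
        ← Finset.sum_neg_distrib]
      refine Finset.sum_congr rfl fun j _ => ?_
      have d := skew (u ∘ₗ L.bracket.flip (s j)) v
      simp only [LinearMap.comp_apply, LinearMap.flip_apply] at d
      simp only [← mul_assoc, ← Finset.sum_mul, ← neg_mul]
      rw [eq_neg_of_add_eq_zero_left d]
    rw [d1, Finset.sum_comm (f := fun j i => u (s j) * _), ← Finset.sum_neg_distrib,
      ← Finset.sum_add_distrib]
    refine Finset.sum_eq_zero fun i _ => ?_
    have d := congrArg (v (a i) * ·) (inv u w (b i))
    simp only [mul_add, Finset.mul_sum, mul_zero] at d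
    rw [← neg_eq_zero, ← d, neg_add, neg_neg, ← Finset.sum_neg_distrib]
    congr 1
    · exact Finset.sum_congr rfl fun j _ => by ring
    · refine Finset.sum_congr rfl fun j _ => ?_
      rw [L.bracket_skew (t j), map_neg]
      ring
  -- Invariance under `s j` removes two of the three `SS` terms; the third survives as the
  -- right-hand side.
  have c4 : ∑ i, ∑ j, u (L.bracket (s i) (s j)) * (v (t i) * w (t j))
      + ∑ i, ∑ j, u (s i) * (v (L.bracket (t i) (s j)) * w (t j)) = 0 := by
    rw [Finset.sum_comm, Finset.sum_comm (f := fun i j => u (s i) * _),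
      ← Finset.sum_add_distrib]
    refine Finset.sum_eq_zero fun j _ => ?_
    simp only [← mul_assoc, ← Finset.sum_mul, ← add_mul, L.bracket_skew _ (s j), map_neg,
      neg_mul, mul_neg, Finset.sum_neg_distrib, ← neg_add, inv, neg_zero, zero_mul]
  simp only [Finset.sum_add_distrib]
  linear_combination e - c1 - c2 - c3 - c4

end Algebra

/-! ### Skew-symmetric and symmetric parts -/

section Parts

variable {h : Type*} [AddCommGroup h] [Module ℝ h]

theorem skewPart_add_symmPart (r : h ⊗[ℝ] h) : skewPart r + symmPart r = r := by
  rw [skewPart, symmPart, ← smul_add, sub_add_add_cancel, ← two_smul ℝ r, smul_smul]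
  norm_num

theorem comm_skewPart (r : h ⊗[ℝ] h) : TensorProduct.comm ℝ h h (skewPart r) = -skewPart r := by
  have e : TensorProduct.comm ℝ h h (TensorProduct.comm ℝ h h r) = r := by
    induction r with
    | zero => simp
    | tmul x y => simp
    | add x y hx hy => rw [map_add, map_add, hx, hy]
  rw [skewPart, map_smul, map_sub, e, ← smul_neg, neg_sub]

theorem map_comm (p : h →ₗ[ℝ] h) (r : h ⊗[ℝ] h) :
    TensorProduct.map p p (TensorProduct.comm ℝ h h r)
      = TensorProduct.comm ℝ h h (TensorProduct.map p p r) := by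
  induction r with
  | zero => simp
  | tmul x y => simp
  | add x y hx hy => simp only [map_add, hx, hy]

theorem map_skewPart (p : h →ₗ[ℝ] h) {r : h ⊗[ℝ] h} (hr : TensorProduct.map p p r = r) :
    TensorProduct.map p p (skewPart r) = skewPart r := by
  rw [skewPart, map_smul, map_sub, map_comm, hr]

theorem map_symmPart (p : h →ₗ[ℝ] h) {r : h ⊗[ℝ] h} (hr : TensorProduct.map p p r = r) :
    TensorProduct.map p p (symmPart r) = symmPart r := by
  rw [symmPart, map_smul, map_add, map_comm, hr]

theorem HomLieAlgebra.sharp_sum (L : HomLieAlgebra h) {ι : Type*} [Fintype ι] (s t : ι → h)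
    (ξ : Module.Dual ℝ h) :
    L.sharp (∑ i, s i ⊗ₜ[ℝ] t i) ξ = ∑ i, ξ (L.phi (s i)) • t i := by
  simp [HomLieAlgebra.sharp]

end Parts

/-! ### Tensors in `h ⊗ h` as bilinear operators on functions. -/

section TensorOp

variable {n : ℕ} {M : Type*} [TopologicalSpace M] [ChartedSpace (EuclideanSpace ℝ (Fin n)) M]
  {h : Type*} [AddCommGroup h] [Module ℝ h]
  (D : h →ₗ[ℝ] (SmoothFun n M →ₗ[ℝ] SmoothFun n M))

theorem smoothFun_sum_apply {ι : Type*} [Fintype ι] (F : ι → SmoothFun n M) (m : M) :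
    (∑ i, F i) m = ∑ i, F i m :=
  map_sum (⟨⟨fun f => f m, rfl⟩, fun _ _ => rfl⟩ : SmoothFun n M →+ ℝ) F _

theorem tensorOp_sum {ι : Type*} [Fintype ι] (x y : ι → h) (f g : SmoothFun n M) :
    tensorOp D (∑ i, x i ⊗ₜ[ℝ] y i) f g = ∑ i, D (x i) f * D (y i) g := by
  simp [tensorOp]

theorem tensorOp_add (r s : h ⊗[ℝ] h) : tensorOp D (r + s) = tensorOp D r + tensorOp D s := by
  funext f g
  simp [tensorOp]

theorem tensorOp_neg (r : h ⊗[ℝ] h) : tensorOp D (-r) = -tensorOp D r := by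
  funext f g
  simp [tensorOp]

theorem tensorOp_comm (r : h ⊗[ℝ] h) (f g : SmoothFun n M) :
    tensorOp D (TensorProduct.comm ℝ h h r) f g = tensorOp D r g f := by
  induction r with
  | zero => simp [tensorOp]
  | tmul x y => simp [tensorOp, mul_comm]
  | add x y hx hy => rw [map_add, tensorOp_add, tensorOp_add]; simp only [Pi.add_apply, hx, hy]

theorem tensorOp_skewPart_swap (r : h ⊗[ℝ] h) (f g : SmoothFun n M) :
    tensorOp D (skewPart r) f g = -tensorOp D (skewPart r) g f := by
  rw [← tensorOp_comm, comm_skewPart, tensorOp_neg]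
  simp

theorem tensorOp_skewPart_mem_span (r : h ⊗[ℝ] h) :
    tensorOp D (skewPart r) ∈ Submodule.span ℝ {ρ | ∃ x y : h, ρ = wedge₂ (D x) (D y)} := by
  obtain ⟨k, x, y, hxy⟩ := TensorProduct.exists_sum_tmul_eq r
  have e : tensorOp D (skewPart r) = ∑ i, (1 / 2 : ℝ) • wedge₂ (D (x i)) (D (y i)) := by
    funext f g
    rw [hxy, skewPart]
    simp [tensorOp, wedge₂, Finset.sum_apply, Finset.smul_sum, ← Finset.sum_sub_distrib,
      smul_sub]
  rw [e]
  exact Submodule.sum_mem _ fun i _ => Submodule.smul_mem _ _ (Submodule.subset_span ⟨_, _, rfl⟩)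

end TensorOp

/-! ### Lie algebra actions -/

section Actions

variable {n : ℕ} {M : Type*} [TopologicalSpace M] [ChartedSpace (EuclideanSpace ℝ (Fin n)) M]
  [IsManifold (𝓡 n) ∞ M] {h : Type*} [AddCommGroup h] [Module ℝ h]

/-- `σ` maps the bracket of `L` to the commutator of vector fields. -/
def PreservesBracket (L : HomLieAlgebra h) (σ : h →ₗ[ℝ] VectorFields n M) : Prop :=
  ∀ (x y : h) (f : SmoothFun n M), lieDeriv (σ (L.bracket x y)) f
    = lieDeriv (σ x) (lieDeriv (σ y) f) - lieDeriv (σ y) (lieDeriv (σ x) f)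

theorem lieDeriv_bracket_sharp (L : HomLieAlgebra h) (hL : L.phi = LinearMap.id)
    (σ : h →ₗ[ℝ] VectorFields n M) {κ : Type*} [Fintype κ] (s t : κ → h) (m : M)
    (f g k : SmoothFun n M) :
    lieDeriv (σ (L.bracket (L.sharp (∑ i, s i ⊗ₜ[ℝ] t i) (actionCovector σ m f))
      (L.sharp (∑ i, s i ⊗ₜ[ℝ] t i) (actionCovector σ m g)))) k m
    = (∑ i, ∑ j, lieDeriv (σ (s i)) f * (lieDeriv (σ (s j)) g *
        lieDeriv (σ (L.bracket (t i) (t j))) k)) m := by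
  have hc : ∀ (f : SmoothFun n M) a, actionCovector σ m f a = lieDeriv (σ a) f m := fun _ _ => rfl
  rw [← hc]
  simp only [L.sharp_sum, hL, LinearMap.id_apply, map_sum, map_smul, LinearMap.sum_apply,
    LinearMap.smul_apply, smul_eq_mul, ContMDiffMap.coe_mul, ContMDiffMap.coe_smul, smoothFun_sum_apply,
    Pi.mul_apply, Pi.smul_apply,    hc, Finset.mul_sum]
  rw [Finset.sum_comm]
  exact Finset.sum_congr rfl fun i _ => Finset.sum_congr rfl fun j _ => by ring

/-- The central identity: the Jacobi sum is first the Yang-Baxter expression of `Λ`, then minus its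
`S` counterpart, and contracting that with `f` and `g` at `m` produces the two values of `S^♯`. -/
theorem jacobiator_sigma_skewPart_apply (L : HomLieAlgebra h) (hL : L.phi = LinearMap.id)
    {σ : h →ₗ[ℝ] VectorFields n M} (hσ : PreservesBracket L σ) {r : h ⊗[ℝ] h}
    (hr : L.IsQuasiTriangular r) (f g k : SmoothFun n M) (m : M) :
    (sigma σ (skewPart r) f (sigma σ (skewPart r) g k)
      + sigma σ (skewPart r) g (sigma σ (skewPart r) k f)
      + sigma σ (skewPart r) k (sigma σ (skewPart r) f g)) m
    = -lieDeriv (σ (L.bracket (L.sharp (symmPart r) (actionCovector σ m f))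
        (L.sharp (symmPart r) (actionCovector σ m g)))) k m := by
  obtain ⟨_, a, b, hab⟩ := TensorProduct.exists_sum_tmul_eq (skewPart r)
  obtain ⟨_, s, t, hst⟩ := TensorProduct.exists_sum_tmul_eq (symmPart r)
  have hskew : ∑ i, a i ⊗ₜ[ℝ] b i = -∑ i, b i ⊗ₜ[ℝ] a i := by
    have e := comm_skewPart r
    rw [hab] at e
    rw [← neg_eq_iff_eq_neg, ← e]
    simp
  have hinv := hr.invariant
  have hcyb := hr.hcybe
  rw [← skewPart_add_symmPart r, hab, hst] at hcyb
  rw [hst] at hinv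
  have e := tripleEval_cyb_skew L hL a b s t hskew hinv hcyb
    ((lieDeriv ∘ₗ σ).flip f) ((lieDeriv ∘ₗ σ).flip g) ((lieDeriv ∘ₗ σ).flip k)
  simp only [LinearMap.flip_apply, LinearMap.comp_apply] at e
  rw [hst, lieDeriv_bracket_sharp L hL,
    jacobiator_of_skew (fun i => lieDeriv (σ (a i))) (fun i => lieDeriv (σ (b i)))
      (fun _ => lieDeriv_mul _) (fun _ => lieDeriv_mul _) (sigma σ (skewPart r))
      (fun f g => by rw [sigma, hab, tensorOp_sum]; rfl)
      (tensorOp_skewPart_swap _ r)]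
  simp only [← hσ _ _ _]
  rw [e]
  rfl

theorem jacobi_sigma_skewPart_iff [T2Space M] (L : HomLieAlgebra h) (hL : L.phi = LinearMap.id)
    {σ : h →ₗ[ℝ] VectorFields n M} (hσ : PreservesBracket L σ) {r : h ⊗[ℝ] h}
    (hr : L.IsQuasiTriangular r) :
    (∀ f g k, sigma σ (skewPart r) f (sigma σ (skewPart r) g k)
      + sigma σ (skewPart r) g (sigma σ (skewPart r) k f)
      + sigma σ (skewPart r) k (sigma σ (skewPart r) f g) = 0) ↔
    ∀ m, ∀ ξ ∈ (stabilizer σ m).dualAnnihilator, ∀ η ∈ (stabilizer σ m).dualAnnihilator,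
      L.bracket (L.sharp (symmPart r) ξ) (L.sharp (symmPart r) η) ∈ stabilizer σ m := by
  constructor
  · intro H m ξ hξ η hη
    obtain ⟨f, rfl⟩ := exists_actionCovector_eq σ m hξ
    obtain ⟨g, rfl⟩ := exists_actionCovector_eq σ m hη
    rw [mem_stabilizer_iff]
    intro k
    rw [← neg_eq_zero, ← jacobiator_sigma_skewPart_apply L hL hσ hr, H]
    rfl
  · intro H f g k
    ext m
    rw [jacobiator_sigma_skewPart_apply L hL hσ hr, (mem_stabilizer_iff σ m _).1
      (H m _ (actionCovector_mem σ m f) _ (actionCovector_mem σ m g)), neg_zero]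
    rfl

theorem bracket_mem_stabilizer [T2Space M] {L : HomLieAlgebra h} {σ : h →ₗ[ℝ] VectorFields n M}
    (hσ : PreservesBracket L σ) {m : M} {a b : h} (ha : a ∈ stabilizer σ m)
    (hb : b ∈ stabilizer σ m) : L.bracket a b ∈ stabilizer σ m := by
  rw [mem_stabilizer_iff] at *
  intro f
  rw [hσ]
  simp [ha, hb]

theorem isPoisson_sigma_skewPart_iff [T2Space M] (L : HomLieAlgebra h)
    (hL : L.phi = LinearMap.id) {σ : h →ₗ[ℝ] VectorFields n M} (hσ : PreservesBracket L σ)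
    {r : h ⊗[ℝ] h} (hr : L.IsQuasiTriangular r) :
    IsPoisson (sigma σ (skewPart r)) ↔
    ∀ m, ∀ ξ ∈ (stabilizer σ m).dualAnnihilator, ∀ η ∈ (stabilizer σ m).dualAnnihilator,
      L.bracket (L.sharp (symmPart r) ξ) (L.sharp (symmPart r) η) ∈ stabilizer σ m := by
  rw [← jacobi_sigma_skewPart_iff L hL hσ hr]
  refine and_iff_right (Submodule.span_mono ?_ (tensorOp_skewPart_mem_span _ r))
  rintro _ ⟨x, y, rfl⟩
  exact ⟨σ x, σ y, rfl⟩

end Actions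

/-! ### Reduction of involutive hom-Lie algebras to Lie algebras -/

section Untwist

variable {h : Type*} [AddCommGroup h] [Module ℝ h]

/-- The Lie algebra `(h, φ ∘ [·,·])` of an involutive hom-Lie algebra. -/
def HomLieAlgebra.untwist (L : HomLieAlgebra h) (hL : L.IsInvolutive) : HomLieAlgebra h where
  bracket := L.bracket.compr₂ L.phi
  phi := LinearMap.id
  bracket_self x := by simp [L.bracket_self]
  phi_bracket x y := rfl
  hom_jacobi x y z := by
    have e := L.hom_jacobi x y z
    have hp : ∀ u v w, L.phi (L.bracket u (L.phi (L.bracket v w)))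
        = L.bracket (L.phi u) (L.bracket v w) := fun u v w => by
      rw [L.phi_bracket, hL]
    simpa only [LinearMap.compr₂_apply, LinearMap.id_apply, hp] using e

variable {L : HomLieAlgebra h} (hL : L.IsInvolutive)

theorem HomLieAlgebra.IsInvolutive.phi_comp_phi (hL : L.IsInvolutive) :
    L.phi ∘ₗ L.phi = LinearMap.id := LinearMap.ext hL

/-- Applying `φ` to each leg cancels the twists `φ y` by `φ² = id` and turns `[·,·]` into `φ ∘
[·,·]`. -/
theorem HomLieAlgebra.hcyb_untwist (r : h ⊗[ℝ] h) : (L.untwist hL).hcyb r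
    = TensorProduct.map L.phi (TensorProduct.map L.phi L.phi) (L.hcyb r) := by
  obtain ⟨k, x, y, rfl⟩ := TensorProduct.exists_sum_tmul_eq r
  simp only [HomLieAlgebra.hcyb_sum, map_sum, map_add, TensorProduct.map_tmul, hL _]
  rfl

theorem HomLieAlgebra.IsQuasiTriangular.untwist {r : h ⊗[ℝ] h} (hr : L.IsQuasiTriangular r) :
    (L.untwist hL).IsQuasiTriangular r where
  map_phi := LinearMap.congr_fun TensorProduct.map_id r
  invariant x := by
    have e := congrArg (TensorProduct.map L.phi L.phi) (hr.invariant x)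
    rw [map_add, ← LinearMap.comp_apply, ← LinearMap.comp_apply, ← TensorProduct.map_comp,
      ← TensorProduct.map_comp, hL.phi_comp_phi, map_zero] at e
    exact e
  hcybe := by rw [HomLieAlgebra.hcyb_untwist, hr.hcybe, map_zero]

/-- Replacing `s` by `(φ ⊗ φ) s` cancels the `φ` inside `ξ` and moves it to the second leg. -/
theorem HomLieAlgebra.sharp_eq_phi_sharp_untwist {s : h ⊗[ℝ] h}
    (hs : TensorProduct.map L.phi L.phi s = s)
    (ξ : Module.Dual ℝ h) : L.sharp s ξ = L.phi ((L.untwist hL).sharp s ξ) := by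
  obtain ⟨k, x, y, hxy⟩ := TensorProduct.exists_sum_tmul_eq s
  have e : s = ∑ i, L.phi (x i) ⊗ₜ[ℝ] L.phi (y i) := by
    rw [← hs, hxy]
    simp
  conv_lhs => rw [e]
  rw [hxy, HomLieAlgebra.sharp_sum, HomLieAlgebra.sharp_sum]
  simp only [hL _, map_sum, map_smul]
  rfl

end Untwist

/-! ### Actions along `φ` as ordinary actions of the untwisted Lie algebra. -/

section HomActions

variable {n : ℕ} {M : Type*} [TopologicalSpace M] [ChartedSpace (EuclideanSpace ℝ (Fin n)) M]
  [IsManifold (𝓡 n) ∞ M] {φ : M ≃ₘ^∞⟮𝓡 n, 𝓡 n⟯ M}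

/-- The vector field `X` with `x = X ∘ φ`. -/
def vectorFieldOf (φ : M ≃ₘ^∞⟮𝓡 n, 𝓡 n⟯ M) : SectionsAlong φ →ₗ[ℝ] VectorFields n M where
  toFun x := ⟨fun q => (x.1 (φ.symm q) : EuclideanSpace ℝ (Fin n)), by
    obtain ⟨X, hX⟩ := x.2
    convert! X.contMDiff using 3 with q
    exact congrArg (Bundle.TotalSpace.mk q) ((hX (φ.symm q)).trans
      (congrArg (fun p => (X p : EuclideanSpace ℝ (Fin n))) (φ.apply_symm_apply q)))⟩
  map_add' x y := rfl
  map_smul' c x := rfl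

theorem vectorFieldOf_apply (x : SectionsAlong φ) (p : M) : vectorFieldOf φ x (φ p) = x.1 p := by
  change (x.1 (φ.symm (φ p)) : EuclideanSpace ℝ (Fin n)) = _
  exact congrArg (fun p => (x.1 p : EuclideanSpace ℝ (Fin n))) (φ.symm_apply_apply p)

theorem sectionDeriv_eq (x : SectionsAlong φ) (f : SmoothFun n M) :
    sectionDeriv φ x f = pullback φ (lieDeriv (vectorFieldOf φ x) f) := by
  ext p
  change (mfderiv (𝓡 n) 𝓘(ℝ, ℝ) f (φ p) (x.1 p) : ℝ)
    = (mfderiv (𝓡 n) 𝓘(ℝ, ℝ) f (φ p) (vectorFieldOf φ x (φ p)) : ℝ)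
  rw [vectorFieldOf_apply]

/-- The hom-Schouten bracket is known only on decomposable bisections, so the formula is checked
there and extended by bilinearity. Arguments are taken in the form `φ* f`, which loses nothing since
`φ*` is bijective. -/
theorem homSchouten_apply (π ρ : Bisections φ) (f g k : SmoothFun n M) :
    homSchouten φ π ρ (pullback φ f) (pullback φ g) (pullback φ k) = -pullback φ
      (π.1 ((pullback φ).symm (ρ.1 f g)) k + π.1 ((pullback φ).symm (ρ.1 g k)) f
        + π.1 ((pullback φ).symm (ρ.1 k f)) g + (ρ.1 ((pullback φ).symm (π.1 f g)) k
        + ρ.1 ((pullback φ).symm (π.1 g k)) f + ρ.1 ((pullback φ).symm (π.1 k f)) g)) := by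
  obtain ⟨π, hπ⟩ := π
  obtain ⟨ρ, hρ⟩ := ρ
  induction hπ using Submodule.span_induction with
  | mem π h =>
    obtain ⟨x, y, rfl⟩ := h
    induction hρ using Submodule.span_induction with
    | mem ρ h =>
      obtain ⟨z, w, rfl⟩ := h
      refine (congrFun (congrFun (congrFun (homSchouten_wedge φ x y z w) _) _) _).trans ?_
      simp only [wedge₂, schoutenWedge, wedge₃,
        opBracket, Ad, Matrix.det_fin_three, Pi.add_apply, Pi.sub_apply, LinearMap.sub_apply,
        LinearMap.comp_apply, AlgEquiv.toLinearMap_apply, map_add, map_sub, map_mul,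
        sectionDeriv_mul, AlgEquiv.apply_symm_apply, AlgEquiv.symm_apply_apply, Matrix.of_apply,
        Matrix.cons_val', Matrix.cons_val_zero, Matrix.cons_val_one, Matrix.cons_val]
      ring
    | zero =>
      refine (congrFun (congrFun (congrFun (homSchouten φ _).map_zero _) _) _).trans ?_
      simp [wedge₂]
    | add ρ ρ' h1 h2 e1 e2 =>
      refine (congrFun (congrFun (congrFun
        ((homSchouten φ _).map_add ⟨ρ, h1⟩ ⟨ρ', h2⟩) _) _) _).trans ?_
      refine (congrArg₂ (· + ·) e1 e2).trans ?_
      simp only [wedge₂, Pi.add_apply, map_add, map_sub, map_mul]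
      ring
    | smul c ρ h e =>
      refine (congrFun (congrFun (congrFun
        ((homSchouten φ _).map_smul c ⟨ρ, h⟩) _) _) _).trans ?_
      refine (congrArg (c • ·) e).trans ?_
      simp only [wedge₂, Pi.smul_apply, map_add, map_sub, map_smul, map_mul, smul_add, smul_neg,
        smul_sub, smul_mul_assoc]
  | zero =>
    refine (congrFun (congrFun (congrFun
      (LinearMap.congr_fun (homSchouten φ).map_zero _) _) _) _).trans ?_
    -- Homogeneity with scalar `0` gives `ρ(0, f) = 0`, which is not immediate for a general element
    -- of the span.
    have e := fun f => Bisections.map_smul_left ⟨ρ, hρ⟩ 0 0 f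
    simp only [zero_smul] at e
    simp [e]
  | add π π' h1 h2 e1 e2 =>
    refine (congrFun (congrFun (congrFun
      (LinearMap.congr_fun ((homSchouten φ).map_add ⟨π, h1⟩ ⟨π', h2⟩) _) _) _) _).trans ?_
    refine (congrArg₂ (· + ·) e1 e2).trans ?_
    have e := Bisections.map_add_left ⟨ρ, hρ⟩
    simp only at e
    simp only [e, Pi.add_apply, map_add]
    ring
  | smul c π h e =>
    refine (congrFun (congrFun (congrFun
      ((homSchouten φ).map_smul₂ c ⟨π, h⟩ ⟨ρ, hρ⟩) _) _) _).trans ?_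
    refine (congrArg (c • ·) e).trans ?_
    have e := Bisections.map_smul_left ⟨ρ, hρ⟩
    simp only at e
    simp only [e, Pi.smul_apply, map_add, map_smul, smul_add, smul_neg]

variable {h : Type*} [AddCommGroup h] [Module ℝ h] {L : HomLieAlgebra h}
  {σ : h →ₗ[ℝ] SectionsAlong φ}

theorem stabilizer_vectorFieldOf (p : M) :
    stabilizer (vectorFieldOf φ ∘ₗ σ) (φ p) = homStabilizer σ p := by
  ext a
  change vectorFieldOf φ (σ a) (φ p) = 0 ↔ (σ a).1 p = 0
  rw [vectorFieldOf_apply]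

theorem homSigma_eq (r : h ⊗[ℝ] h) (f g : SmoothFun n M) :
    homSigma σ r f g = pullback φ (sigma (vectorFieldOf φ ∘ₗ σ) r f g) := by
  obtain ⟨k, x, y, rfl⟩ := TensorProduct.exists_sum_tmul_eq r
  simp only [homSigma, sigma, tensorOp_sum, map_sum, map_mul, LinearMap.comp_apply,
    sectionDeriv_eq]

/-- With `σ(a) = φ* ∘ X_a`, the axioms read `X_{φ a} = φ* X_a (φ*)⁻¹` and `X_{[a,b]} = φ* [X_a, X_b]
(φ*)⁻¹`. Then `X_{φ[a,b]}` is the conjugate of `[X_a, X_b]` by `(φ*)²`, and this conjugation is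
trivial on each `X_a`. -/
theorem preservesBracket_untwist (hL : L.IsInvolutive) (hσ : IsHomAction L φ σ) :
    PreservesBracket (L.untwist hL) (vectorFieldOf φ ∘ₗ σ) := by
  have hphi : ∀ a f, lieDeriv (vectorFieldOf φ (σ (L.phi a))) f
      = pullback φ (lieDeriv (vectorFieldOf φ (σ a)) ((pullback φ).symm f)) := by
    intro a f
    apply (pullback φ).injective
    have e := LinearMap.congr_fun (hσ.map_phi a) f
    simpa only [Ad, LinearMap.comp_apply, AlgEquiv.toLinearMap_apply, sectionDeriv_eq] using e
  have hbr : ∀ a b f, lieDeriv (vectorFieldOf φ (σ (L.bracket a b))) f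
      = pullback φ (lieDeriv (vectorFieldOf φ (σ a)) (lieDeriv (vectorFieldOf φ (σ b))
        ((pullback φ).symm f)) - lieDeriv (vectorFieldOf φ (σ b)) (lieDeriv (vectorFieldOf φ (σ a))
        ((pullback φ).symm f))) := by
    intro a b f
    apply (pullback φ).injective
    have e := LinearMap.congr_fun (hσ.map_bracket a b) f
    simpa only [opBracket, LinearMap.sub_apply, LinearMap.comp_apply, AlgEquiv.toLinearMap_apply,
      sectionDeriv_eq, AlgEquiv.symm_apply_apply, map_sub] using e
  intro x y f
  change lieDeriv (vectorFieldOf φ (σ (L.phi (L.bracket x y)))) f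
    = lieDeriv (vectorFieldOf φ (σ x)) (lieDeriv (vectorFieldOf φ (σ y)) f)
      - lieDeriv (vectorFieldOf φ (σ y)) (lieDeriv (vectorFieldOf φ (σ x)) f)
  rw [L.phi_bracket, hbr]
  simp only [hphi, AlgEquiv.symm_apply_apply, map_sub]
  -- Involutivity of `L.phi` makes `(φ*)²` commute with every `X_a`, although the diffeomorphism
  -- itself need not be an involution.
  have hsq : ∀ a f, lieDeriv (vectorFieldOf φ (σ a)) f = pullback φ (pullback φ
      (lieDeriv (vectorFieldOf φ (σ a)) ((pullback φ).symm ((pullback φ).symm f)))) := by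
    intro a f
    conv_lhs => rw [← hL a, hphi, hphi]
  rw [hsq x (lieDeriv (vectorFieldOf φ (σ y)) f), hsq y (lieDeriv (vectorFieldOf φ (σ x)) f),
    hsq x f, hsq y f]
  simp only [AlgEquiv.symm_apply_apply]

theorem Ad_homSigma (hσ : IsHomAction L φ σ) {r : h ⊗[ℝ] h}
    (hr : TensorProduct.map L.phi L.phi r = r) (f g : SmoothFun n M) :
    pullback φ (homSigma σ r ((pullback φ).symm f) ((pullback φ).symm g)) = homSigma σ r f g := by
  obtain ⟨k, x, y, hxy⟩ := TensorProduct.exists_sum_tmul_eq r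
  have e : r = ∑ i, L.phi (x i) ⊗ₜ[ℝ] L.phi (y i) := by
    rw [← hr, hxy]
    simp
  conv_rhs => rw [e]
  rw [hxy]
  simp only [homSigma, tensorOp_sum, map_sum, map_mul, LinearMap.comp_apply, hσ.map_phi]
  rfl

theorem isHomPoisson_homSigma_skewPart_iff_jacobi (hσ : IsHomAction L φ σ) {r : h ⊗[ℝ] h}
    (hr : TensorProduct.map L.phi L.phi r = r) :
    IsHomPoisson φ (homSigma σ (skewPart r)) ↔
    ∀ f g k, sigma (vectorFieldOf φ ∘ₗ σ) (skewPart r)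
        f (sigma (vectorFieldOf φ ∘ₗ σ) (skewPart r) g k)
      + sigma (vectorFieldOf φ ∘ₗ σ) (skewPart r) g (sigma (vectorFieldOf φ ∘ₗ σ) (skewPart r) k f)
      + sigma (vectorFieldOf φ ∘ₗ σ) (skewPart r) k (sigma (vectorFieldOf φ ∘ₗ σ) (skewPart r) f g)
      = 0 := by
  have hmem : homSigma σ (skewPart r) ∈ Bisections φ := by
    refine Submodule.span_mono ?_ (tensorOp_skewPart_mem_span _ r)
    rintro _ ⟨x, y, rfl⟩
    exact ⟨σ x, σ y, rfl⟩
  have hskew : ∀ f g, sigma (vectorFieldOf φ ∘ₗ σ) (skewPart r) f g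
      = -sigma (vectorFieldOf φ ∘ₗ σ) (skewPart r) g f := tensorOp_skewPart_swap _ r
  -- For `π = ρ` the two cyclic sums of `homSchouten_apply` coincide, whence the factor `2`;
  -- skewness, used to put the inner bracket second, absorbs the sign.
  have key : ∀ f g k, homSchouten φ ⟨_, hmem⟩ ⟨_, hmem⟩ (pullback φ f) (pullback φ g)
      (pullback φ k) = (2 : ℝ) • pullback φ (pullback φ
      (sigma (vectorFieldOf φ ∘ₗ σ) (skewPart r)
        f (sigma (vectorFieldOf φ ∘ₗ σ) (skewPart r) g k)
      + sigma (vectorFieldOf φ ∘ₗ σ) (skewPart r) g (sigma (vectorFieldOf φ ∘ₗ σ) (skewPart r) k f)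
      + sigma (vectorFieldOf φ ∘ₗ σ) (skewPart r) k
        (sigma (vectorFieldOf φ ∘ₗ σ) (skewPart r) f g))) := by
    intro f g k
    rw [homSchouten_apply]
    simp only [homSigma_eq, AlgEquiv.symm_apply_apply]
    rw [hskew (sigma _ _ f g), hskew (sigma _ _ g k), hskew (sigma _ _ k f)]
    simp only [map_add, map_neg, two_smul]
    ring
  constructor
  · rintro ⟨⟨hm, H⟩, -⟩ f g k
    have e := key f g k
    rw [H] at e
    have e' := (smul_eq_zero.1 (e.symm.trans rfl)).resolve_left (two_ne_zero (α := ℝ))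
    rwa [EmbeddingLike.map_eq_zero_iff, EmbeddingLike.map_eq_zero_iff] at e'
  · intro H
    refine ⟨⟨hmem, ?_⟩, Ad_homSigma hσ (map_skewPart _ hr)⟩
    funext f g k
    have e := key ((pullback φ).symm f) ((pullback φ).symm g) ((pullback φ).symm k)
    simp only [H, AlgEquiv.apply_symm_apply, map_zero, smul_zero] at e
    exact e

theorem isHomPoisson_homSigma_skewPart_iff [T2Space M] (hL : L.IsInvolutive)
    (hσ : IsHomAction L φ σ) {r : h ⊗[ℝ] h} (hr : L.IsQuasiTriangular r) :
    IsHomPoisson φ (homSigma σ (skewPart r)) ↔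
      ∀ y, ∀ ξ ∈ (homStabilizer σ y).dualAnnihilator, ∀ η ∈ (homStabilizer σ y).dualAnnihilator,
        L.bracket (L.sharp (symmPart r) ξ) (L.sharp (symmPart r) η) ∈ homStabilizer σ y := by
  rw [isHomPoisson_homSigma_skewPart_iff_jacobi hσ hr.map_phi,
    jacobi_sigma_skewPart_iff (L.untwist hL) rfl (preservesBracket_untwist hL hσ)
      (hr.untwist hL),
    -- The section `σ(a)` at `y` is the vector field `X_a` at `φ y`, so base points are
    -- reparametrized by `φ`.
    (EquivLike.surjective φ).forall]
  simp only [stabilizer_vectorFieldOf, HomLieAlgebra.sharp_eq_phi_sharp_untwist hL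
    (map_symmPart _ hr.map_phi), ← L.phi_bracket]
  rfl

theorem isHomPoisson_homSigma [T2Space M] (hL : L.IsInvolutive)
    (hσ : IsHomAction L φ σ) {r : h ⊗[ℝ] h} (hr : L.IsQuasiTriangular r)
    (hphi : ∀ y, ∀ a ∈ homStabilizer σ y, L.phi a ∈ homStabilizer σ y)
    (hS : ∀ y, ∀ ξ ∈ (homStabilizer σ y).dualAnnihilator,
      L.sharp (symmPart r) ξ ∈ homStabilizer σ y) :
    IsHomPoisson φ (homSigma σ r) := by
  -- At `φ y`, contracting `S` with `f` and `g` is `X_b g` for `b = φ(S^♯ ξ)`, where `ξ` is the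
  -- covector of `f`; both hypotheses together put `b` in the stabilizer.
  have hzero : homSigma σ (symmPart r) = 0 := by
    funext f g
    rw [homSigma_eq, Pi.zero_apply, Pi.zero_apply, EmbeddingLike.map_eq_zero_iff]
    ext q
    obtain ⟨y, rfl⟩ := φ.surjective q
    obtain ⟨k, s, t, hst⟩ := TensorProduct.exists_sum_tmul_eq (symmPart r)
    have hξ := actionCovector_mem (vectorFieldOf φ ∘ₗ σ) (φ y) f
    rw [stabilizer_vectorFieldOf] at hξ
    have hm := hphi y _ (hS y _ hξ)
    rw [HomLieAlgebra.sharp_eq_phi_sharp_untwist hL (map_symmPart _ hr.map_phi), hL,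
      ← stabilizer_vectorFieldOf, mem_stabilizer_iff] at hm
    have e := hm g
    change actionCovector (vectorFieldOf φ ∘ₗ σ) (φ y) g _ = 0 at e
    rw [hst, HomLieAlgebra.sharp_sum, map_sum] at e
    rw [hst, sigma, tensorOp_sum, smoothFun_sum_apply]
    simp only [map_smul] at e
    exact e
  have hr' : homSigma σ r = homSigma σ (skewPart r) := by
    conv_lhs => rw [← skewPart_add_symmPart r]
    rw [homSigma, tensorOp_add]
    change homSigma σ (skewPart r) + homSigma σ (symmPart r) = _
    rw [hzero, add_zero]
  rw [hr', isHomPoisson_homSigma_skewPart_iff hL hσ hr]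
  intro y ξ hξ η hη
  -- Writing the bracket as `φ(φ[·,·])` exposes the Lie bracket `φ[·,·]`, under which the stabilizer
  -- is closed.
  rw [← hL (L.bracket _ _)]
  refine hphi y _ ?_
  rw [← stabilizer_vectorFieldOf] at *
  exact bracket_mem_stabilizer (preservesBracket_untwist hL hσ)
    (stabilizer_vectorFieldOf (σ := σ) y ▸ hS y ξ (stabilizer_vectorFieldOf (σ := σ) y ▸ hξ))
    (stabilizer_vectorFieldOf (σ := σ) y ▸ hS y η (stabilizer_vectorFieldOf (σ := σ) y ▸ hη))

end HomActions

/-! ### Manin triples -/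

section Manin

variable {d : Type*} [LieRing d] [LieAlgebra ℝ d]

/-- Invariance of the Casimir element: for dual bases `e`, `e'`, the form's invariance makes `B ⁅x,
e i⁆ (e' j)` and `B ⁅x, e' j⁆ (e i)` opposite. -/
theorem sum_tmul_bracket_add_eq_zero (B : LinearMap.BilinForm ℝ d)
    (hB : ∀ a b c, B ⁅a, b⁆ c = B a ⁅b, c⁆) (hs : ∀ a b, B a b = B b a)
    {κ : Type*} [Fintype κ] (e e' : κ → d)
    (he : ∀ a, a = ∑ i, B a (e' i) • e i) (he' : ∀ a, a = ∑ i, B a (e i) • e' i) (x : d) :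
    ∑ i, (⁅x, e i⁆ ⊗ₜ[ℝ] e' i + e i ⊗ₜ[ℝ] ⁅x, e' i⁆) = 0 := by
  have h1 : ∀ i, ⁅x, e i⁆ ⊗ₜ[ℝ] e' i = ∑ j, B ⁅x, e i⁆ (e' j) • (e j ⊗ₜ[ℝ] e' i) := by
    intro i
    conv_lhs => rw [he ⁅x, e i⁆, TensorProduct.sum_tmul]
    simp only [TensorProduct.smul_tmul']
  have h2 : ∀ i, e i ⊗ₜ[ℝ] ⁅x, e' i⁆ = ∑ j, B ⁅x, e' i⁆ (e j) • (e i ⊗ₜ[ℝ] e' j) := by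
    intro i
    conv_lhs => rw [he' ⁅x, e' i⁆, TensorProduct.tmul_sum]
    simp only [TensorProduct.tmul_smul]
  rw [Finset.sum_add_distrib, Finset.sum_congr rfl fun i _ => h1 i,
    Finset.sum_congr rfl fun i _ => h2 i, Finset.sum_comm, ← Finset.sum_add_distrib]
  refine Finset.sum_eq_zero fun j _ => ?_
  rw [← Finset.sum_add_distrib]
  refine Finset.sum_eq_zero fun i _ => ?_
  rw [← add_smul, ← lie_skew x (e i), map_neg, LinearMap.neg_apply, hB, hs (e i), neg_add_cancel,
    zero_smul]

variable (T : ManinTriple d) {ι : Type*} [Fintype ι] {ξ : Module.Basis ι ℝ T.g₂}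
  {x : Module.Basis ι ℝ T.g₁}

theorem ManinTriple.eq_sum (h1 : ∀ i, T.form (x i) (ξ i) = 1)
    (h0 : ∀ i j, i ≠ j → T.form (x i) (ξ j) = 0) (a : d) :
    a = ∑ i, T.form a (ξ i) • (x i : d) + ∑ i, T.form a (x i) • (ξ i : d) := by
  classical
  have hd : ∀ i j, T.form (x i) (ξ j) = if i = j then 1 else 0 := by
    intro i j
    split_ifs with hij
    · rw [← hij, h1]
    · exact h0 i j hij
  have h11 : ∀ i j, T.form (x i) (x j) = 0 := fun i j =>
    T.isotropic₁ _ (x i).2 _ (x j).2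
  have h22 : ∀ i j, T.form (ξ i) (ξ j) = 0 := fun i j =>
    T.isotropic₂ _ (ξ i).2 _ (ξ j).2
  obtain ⟨u, hu, v, hv, rfl⟩ := Submodule.mem_sup.1
    (T.isCompl.sup_eq_top ▸ Submodule.mem_top : a ∈ T.g₁.toSubmodule ⊔ T.g₂.toSubmodule)
  obtain ⟨p, rfl⟩ : ∃ p : ι → ℝ, u = ∑ i, p i • (x i : d) := by
    have e := congrArg (Submodule.subtype T.g₁.toSubmodule) (x.sum_repr ⟨u, hu⟩)
    rw [map_sum] at e
    exact ⟨_, e.symm⟩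
  obtain ⟨q, rfl⟩ : ∃ q : ι → ℝ, v = ∑ i, q i • (ξ i : d) := by
    have e := congrArg (Submodule.subtype T.g₂.toSubmodule) (ξ.sum_repr ⟨v, hv⟩)
    rw [map_sum] at e
    exact ⟨_, e.symm⟩
  have hd' : ∀ i j, T.form (ξ i) (x j) = if j = i then 1 else 0 := fun i j => by
    rw [T.symm, hd]
  simp [hd, hd', h11, h22]

/-- Exhibits `S` as half the Casimir element, for the dual bases `(x, ξ)` and `(ξ, x)` of `d`
indexed by `ι ⊕ ι`. -/
theorem ManinTriple.symmPart_eq :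
    symmPart (∑ i, (ξ i : d) ⊗ₜ[ℝ] (x i : d))
      = ∑ i : ι ⊕ ι, ((1 / 2 : ℝ) • Sum.elim (fun i => (x i : d)) (fun i => (ξ i : d)) i)
          ⊗ₜ[ℝ] Sum.elim (fun i => (ξ i : d)) (fun i => (x i : d)) i := by
  simp only [symmPart, map_sum, TensorProduct.comm_tmul, Fintype.sum_sum_type, Sum.elim_inl,
    Sum.elim_inr, smul_add, Finset.smul_sum, TensorProduct.smul_tmul']
  exact add_comm _ _

theorem ManinTriple.sharp_symmPart (h1 : ∀ i, T.form (x i) (ξ i) = 1)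
    (h0 : ∀ i j, i ≠ j → T.form (x i) (ξ j) = 0) (a : d) :
    (HomLieAlgebra.ofLie d).sharp (symmPart (∑ i, (ξ i : d) ⊗ₜ[ℝ] (x i : d))) (T.form a)
      = (1 / 2 : ℝ) • a := by
  rw [T.symmPart_eq, HomLieAlgebra.sharp_sum]
  conv_rhs => rw [T.eq_sum h1 h0 a]
  simp only [HomLieAlgebra.ofLie, LinearMap.id_apply, Fintype.sum_sum_type, Sum.elim_inl,
    Sum.elim_inr, map_smul, smul_assoc, smul_add, Finset.smul_sum]
  exact add_comm _ _

/-- Since `g₁` and `g₂` are subalgebras, `⁅ξ i, ξ j⁆` expands in the `ξ l` and `⁅x i, x j⁆` in the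
`x l`. The two components of `⁅x i, ξ j⁆` cancel these terms one each, by invariance of the form. -/
theorem ManinTriple.hcyb_eq_zero (h1 : ∀ i, T.form (x i) (ξ i) = 1)
    (h0 : ∀ i j, i ≠ j → T.form (x i) (ξ j) = 0) :
    (HomLieAlgebra.ofLie d).hcyb (∑ i, (ξ i : d) ⊗ₜ[ℝ] (x i : d)) = 0 := by
  have e₁ : ∀ a ∈ T.g₁, a = ∑ i, T.form a (ξ i) • (x i : d) := by
    intro a ha
    have e := T.eq_sum h1 h0 a
    simpa only [T.isotropic₁ a ha _ (x _).2, zero_smul, Finset.sum_const_zero, add_zero] using e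
  have e₂ : ∀ a ∈ T.g₂, a = ∑ i, T.form a (x i) • (ξ i : d) := by
    intro a ha
    have e := T.eq_sum h1 h0 a
    simpa only [T.isotropic₂ a ha _ (ξ _).2, zero_smul, Finset.sum_const_zero, zero_add] using e
  have f₁ : ∀ i j, ⁅(ξ i : d), (ξ j : d)⁆ ⊗ₜ[ℝ] ((x i : d) ⊗ₜ[ℝ] (x j : d))
      = ∑ l, T.form ⁅(ξ i : d), (ξ j : d)⁆ (x l) • ((ξ l : d) ⊗ₜ[ℝ] ((x i : d) ⊗ₜ[ℝ] (x j : d))) := by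
    intro i j
    conv_lhs => rw [e₂ _ (T.g₂.lie_mem (ξ i).2 (ξ j).2), TensorProduct.sum_tmul]
    simp only [TensorProduct.smul_tmul']
  have f₃ : ∀ i j, (ξ i : d) ⊗ₜ[ℝ] ((ξ j : d) ⊗ₜ[ℝ] ⁅(x i : d), (x j : d)⁆)
      = ∑ l, T.form ⁅(x i : d), (x j : d)⁆ (ξ l) • ((ξ i : d) ⊗ₜ[ℝ] ((ξ j : d) ⊗ₜ[ℝ] (x l : d))) := by
    intro i j
    conv_lhs => rw [e₁ _ (T.g₁.lie_mem (x i).2 (x j).2), TensorProduct.tmul_sum,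
      TensorProduct.tmul_sum]
    simp only [TensorProduct.tmul_smul]
  have f₂ : ∀ i j, (ξ i : d) ⊗ₜ[ℝ] (⁅(x i : d), (ξ j : d)⁆ ⊗ₜ[ℝ] (x j : d))
      = ∑ l, T.form ⁅(x i : d), (ξ j : d)⁆ (ξ l) • ((ξ i : d) ⊗ₜ[ℝ] ((x l : d) ⊗ₜ[ℝ] (x j : d)))
      + ∑ l, T.form ⁅(x i : d), (ξ j : d)⁆ (x l) • ((ξ i : d) ⊗ₜ[ℝ] ((ξ l : d) ⊗ₜ[ℝ] (x j : d))) := by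
    intro i j
    conv_lhs => rw [T.eq_sum h1 h0 ⁅(x i : d), (ξ j : d)⁆, TensorProduct.add_tmul,
      TensorProduct.sum_tmul, TensorProduct.sum_tmul, TensorProduct.tmul_add,
      TensorProduct.tmul_sum, TensorProduct.tmul_sum]
    simp only [TensorProduct.tmul_smul, ← TensorProduct.smul_tmul']
  have g₁ : ∑ i, ∑ j, ∑ l, T.form ⁅(ξ i : d), (ξ j : d)⁆ (x l) •
        ((ξ l : d) ⊗ₜ[ℝ] ((x i : d) ⊗ₜ[ℝ] (x j : d)))
      = -∑ i, ∑ j, ∑ l, T.form ⁅(x i : d), (ξ j : d)⁆ (ξ l) •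
        ((ξ i : d) ⊗ₜ[ℝ] ((x l : d) ⊗ₜ[ℝ] (x j : d))) := by
    rw [Finset.sum_congr rfl fun i _ => Finset.sum_comm, Finset.sum_comm]
    simp only [← Finset.sum_neg_distrib]
    refine Finset.sum_congr rfl fun l _ => ?_
    rw [Finset.sum_comm]
    refine Finset.sum_congr rfl fun j _ => Finset.sum_congr rfl fun i _ => ?_
    rw [← neg_smul, T.invariant (x l), ← lie_skew, map_neg, LinearMap.neg_apply, T.symm]
  have g₃ : ∑ i, ∑ j, ∑ l, T.form ⁅(x i : d), (x j : d)⁆ (ξ l) •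
        ((ξ i : d) ⊗ₜ[ℝ] ((ξ j : d) ⊗ₜ[ℝ] (x l : d)))
      = -∑ i, ∑ j, ∑ l, T.form ⁅(x i : d), (ξ j : d)⁆ (x l) •
        ((ξ i : d) ⊗ₜ[ℝ] ((ξ l : d) ⊗ₜ[ℝ] (x j : d))) := by
    simp only [← Finset.sum_neg_distrib]
    refine Finset.sum_congr rfl fun i _ => ?_
    rw [Finset.sum_comm]
    refine Finset.sum_congr rfl fun l _ => Finset.sum_congr rfl fun j _ => ?_
    rw [← neg_smul, T.invariant, T.invariant, ← lie_skew, map_neg]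
  rw [HomLieAlgebra.hcyb_sum]
  change ∑ i, ∑ j, (⁅(ξ i : d), (ξ j : d)⁆ ⊗ₜ[ℝ] ((x i : d) ⊗ₜ[ℝ] (x j : d))
    + (ξ i : d) ⊗ₜ[ℝ] (⁅(x i : d), (ξ j : d)⁆ ⊗ₜ[ℝ] (x j : d))
    + (ξ i : d) ⊗ₜ[ℝ] ((ξ j : d) ⊗ₜ[ℝ] ⁅(x i : d), (x j : d)⁆)) = 0
  simp only [f₁, f₂, f₃, Finset.sum_add_distrib, g₁, g₃]
  abel

theorem ManinTriple.isQuasiTriangular (h1 : ∀ i, T.form (x i) (ξ i) = 1)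
    (h0 : ∀ i j, i ≠ j → T.form (x i) (ξ j) = 0) :
    (HomLieAlgebra.ofLie d).IsQuasiTriangular (∑ i, (ξ i : d) ⊗ₜ[ℝ] (x i : d)) where
  map_phi := LinearMap.congr_fun TensorProduct.map_id _
  hcybe := T.hcyb_eq_zero h1 h0
  invariant a := by
    have e := congrArg ((1 / 2 : ℝ) • ·) (sum_tmul_bracket_add_eq_zero T.form T.invariant T.symm
      (Sum.elim (fun i => (x i : d)) (fun i => (ξ i : d)))
      (Sum.elim (fun i => (ξ i : d)) (fun i => (x i : d)))
      (fun a => by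
        simpa only [Fintype.sum_sum_type, Sum.elim_inl, Sum.elim_inr] using T.eq_sum h1 h0 a)
      (fun a => by
        simpa only [Fintype.sum_sum_type, Sum.elim_inl, Sum.elim_inr, add_comm]
          using T.eq_sum h1 h0 a) a)
    rw [T.symmPart_eq, map_sum, map_sum, ← Finset.sum_add_distrib]
    simp only [Finset.smul_sum, smul_add, smul_zero] at e
    simp only [TensorProduct.map_tmul, map_smul, ← TensorProduct.smul_tmul']
    exact e

theorem ManinTriple.exists_form_eq (h1 : ∀ i, T.form (x i) (ξ i) = 1)
    (h0 : ∀ i j, i ≠ j → T.form (x i) (ξ j) = 0) (η : Module.Dual ℝ d) :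
    ∃ a, T.form a = η := by
  refine ⟨∑ i, η (ξ i) • (x i : d) + ∑ i, η (x i) • (ξ i : d), LinearMap.ext fun b => ?_⟩
  conv_rhs => rw [T.eq_sum h1 h0 b]
  simp only [map_add, map_sum, map_smul, LinearMap.add_apply, LinearMap.sum_apply,
    LinearMap.smul_apply, smul_eq_mul]
  rw [add_comm]
  congr 1 <;> exact Finset.sum_congr rfl fun i _ => by rw [T.symm, mul_comm]

variable {n : ℕ} {M : Type*} [TopologicalSpace M] [T2Space M]
  [ChartedSpace (EuclideanSpace ℝ (Fin n)) M] [IsManifold (𝓡 n) ∞ M]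

theorem ManinTriple.isPoisson_sigma_skewPart_iff (h1 : ∀ i, T.form (x i) (ξ i) = 1)
    (h0 : ∀ i j, i ≠ j → T.form (x i) (ξ j) = 0) {σ : d →ₗ[ℝ] VectorFields n M}
    (hσ : IsLieAction σ) :
    IsPoisson (sigma σ (skewPart (∑ i, (ξ i : d) ⊗ₜ[ℝ] (x i : d)))) ↔
      ∀ m, ∀ a ∈ T.form.orthogonal (stabilizer σ m), ∀ b ∈ T.form.orthogonal (stabilizer σ m),
        ⁅a, b⁆ ∈ stabilizer σ m := by
  rw [HomPoisson.isPoisson_sigma_skewPart_iff (HomLieAlgebra.ofLie d) rfl hσ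
    (T.isQuasiTriangular h1 h0)]
  have hmem : ∀ m a, a ∈ T.form.orthogonal (stabilizer σ m)
      ↔ T.form a ∈ (stabilizer σ m).dualAnnihilator := by
    intro m a
    rw [LinearMap.BilinForm.mem_orthogonal_iff, Submodule.mem_dualAnnihilator]
    refine forall₂_congr fun b _ => ?_
    rw [T.symm]
  -- The two factors `1/2` from `S^♯` are invertible scalars and do not affect membership in a
  -- subspace.
  have hbr : ∀ m a b, (HomLieAlgebra.ofLie d).bracket ((1 / 2 : ℝ) • a) ((1 / 2 : ℝ) • b)
      ∈ stabilizer σ m ↔ ⁅a, b⁆ ∈ stabilizer σ m := by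
    intro m a b
    rw [map_smul, map_smul, LinearMap.smul_apply, Submodule.smul_mem_iff _ (by norm_num),
      Submodule.smul_mem_iff _ (by norm_num)]
    rfl
  refine forall_congr' fun m => ⟨fun H a ha b hb => ?_, fun H η hη ζ hζ => ?_⟩
  · have e := H _ ((hmem m a).1 ha) _ ((hmem m b).1 hb)
    rwa [T.sharp_symmPart h1 h0, T.sharp_symmPart h1 h0, hbr] at e
  · obtain ⟨a, rfl⟩ := T.exists_form_eq h1 h0 η
    obtain ⟨b, rfl⟩ := T.exists_form_eq h1 h0 ζ
    rw [T.sharp_symmPart h1 h0, T.sharp_symmPart h1 h0, hbr]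
    exact H a ((hmem m a).2 hη) b ((hmem m b).2 hζ)

end Manin

end HomPoisson

end

theorem theoremB (n : ℕ) (M : Type*) [TopologicalSpace M] [T2Space M]
    [ChartedSpace (EuclideanSpace ℝ (Fin n)) M] [IsManifold (𝓡 n) ∞ M] :
    -- Hom-Lie algebras: `h` an involutive hom-Lie algebra acting on `M` along a diffeomorphism `φ`,
    -- and `r = Λ + S` a quasi-triangular hom-`r`-matrix.
    (∀ (h : Type*) [AddCommGroup h] [Module ℝ h] (L : HomPoisson.HomLieAlgebra h)
      (φ : M ≃ₘ^∞⟮𝓡 n, 𝓡 n⟯ M) (σ : h →ₗ[ℝ] HomPoisson.SectionsAlong φ) (r : h ⊗[ℝ] h),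
      L.IsInvolutive → HomPoisson.IsHomAction L φ σ → L.IsQuasiTriangular r →
        -- If the stabilizers are hom-subalgebras with `S^♯(q_y^⊥) ⊆ q_y`, then `σ(r)` is hom-Poisson.
        ((∀ y, ∀ a ∈ HomPoisson.homStabilizer σ y, L.phi a ∈ HomPoisson.homStabilizer σ y) →
          (∀ y, ∀ ξ ∈ (HomPoisson.homStabilizer σ y).dualAnnihilator,
            L.sharp (HomPoisson.symmPart r) ξ ∈ HomPoisson.homStabilizer σ y) →
          HomPoisson.IsHomPoisson φ (HomPoisson.homSigma σ r)) ∧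
        -- `σ(Λ)` is hom-Poisson iff `[S^♯(q_y^⊥), S^♯(q_y^⊥)] ⊆ q_y` for all `y`.
        (HomPoisson.IsHomPoisson φ (HomPoisson.homSigma σ (HomPoisson.skewPart r)) ↔
          ∀ y, ∀ ξ ∈ (HomPoisson.homStabilizer σ y).dualAnnihilator,
            ∀ η ∈ (HomPoisson.homStabilizer σ y).dualAnnihilator,
              L.bracket (L.sharp (HomPoisson.symmPart r) ξ) (L.sharp (HomPoisson.symmPart r) η)
                ∈ HomPoisson.homStabilizer σ y)) ∧
    -- Lie algebras: `σ(Λ)` is Poisson iff `[S^♯(q_m^⊥), S^♯(q_m^⊥)] ⊆ q_m` for all `m`.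
    (∀ (g : Type*) [LieRing g] [LieAlgebra ℝ g] (σ : g →ₗ[ℝ] HomPoisson.VectorFields n M)
      (r : g ⊗[ℝ] g), HomPoisson.IsLieAction σ →
      (HomPoisson.HomLieAlgebra.ofLie g).IsQuasiTriangular r →
        (HomPoisson.IsPoisson (HomPoisson.sigma σ (HomPoisson.skewPart r)) ↔
          ∀ m, ∀ ξ ∈ (HomPoisson.stabilizer σ m).dualAnnihilator,
            ∀ η ∈ (HomPoisson.stabilizer σ m).dualAnnihilator,
              ⁅(HomPoisson.HomLieAlgebra.ofLie g).sharp (HomPoisson.symmPart r) ξ,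
                (HomPoisson.HomLieAlgebra.ofLie g).sharp (HomPoisson.symmPart r) η⁆
                ∈ HomPoisson.stabilizer σ m)) ∧
    -- Manin triples, with `r = ∑ ξᵢ ⊗ xᵢ`: `σ(Λ)` is Poisson iff `[q_m^⊥, q_m^⊥] ⊆ q_m` for all
    -- `m`, the orthogonals being taken with respect to the bilinear form of the Manin triple.
    (∀ (d : Type*) [LieRing d] [LieAlgebra ℝ d] (T : HomPoisson.ManinTriple d)
      (ι : Type*) [Fintype ι] (ξ : Module.Basis ι ℝ T.g₂) (x : Module.Basis ι ℝ T.g₁)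
      (σ : d →ₗ[ℝ] HomPoisson.VectorFields n M),
      (∀ i, T.form (x i) (ξ i) = 1) → (∀ i j, i ≠ j → T.form (x i) (ξ j) = 0) →
      HomPoisson.IsLieAction σ →
        (HomPoisson.IsPoisson (HomPoisson.sigma σ
            (HomPoisson.skewPart (∑ i, (ξ i : d) ⊗ₜ[ℝ] (x i : d)))) ↔
          ∀ m, ∀ a ∈ T.form.orthogonal (HomPoisson.stabilizer σ m),
            ∀ b ∈ T.form.orthogonal (HomPoisson.stabilizer σ m),
              ⁅a, b⁆ ∈ HomPoisson.stabilizer σ m)) := by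
  refine ⟨fun h _ _ L φ σ r hL hσ hr => ⟨fun hphi hS => ?_, ?_⟩, fun g _ _ σ r hσ hr => ?_,
    fun d _ _ T ι _ ξ x σ h1 h0 hσ => ?_⟩
  · exact HomPoisson.isHomPoisson_homSigma hL hσ hr hphi hS
  · exact HomPoisson.isHomPoisson_homSigma_skewPart_iff hL hσ hr
  · exact HomPoisson.isPoisson_sigma_skewPart_iff (HomPoisson.HomLieAlgebra.ofLie g) rfl hσ hr
  · exact T.isPoisson_sigma_skewPart_iff h1 h0 hσ
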